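/- Let $N\ge 2$ and let $X=\{0,1,\dots,N-1\}$ with the metric $d(j,k)=|k-j|\,(N-|k-j|)$. For $f\in\mathbb R^X$ and an unordered pair $(j,k)$ of points of $X$ put $\tilde f(j,k)=\frac12\bigl(f(j)+f(k)-d(j,k)\bigr)$; the set $\mathfrak X$ of unordered pairs (with $j=k$ allowed) is a discrete Möbius strip, its elements are called sites, and a coordinate $N$ is identified with $0$. Let $\Delta(X)=\{f\in\mathbb R^X\mid \tilde f\ge 0\text{ on }\mathfrak X\}$, and let $\operatorname{E}(X)=\{f\in\Delta(X)\mid \forall j\in X\ \exists k\in X:\tilde f(j,k)=0\}$ be the injective hull of $X$, regarded as the polyhedral complex of the bounded nonempty faces of the polyhedron $\Delta(X)$. Let $\mathbb Y_N$ be the set of integer partitions all of whose hook lengths are $<N$. Draw $\lambda=(\lambda_1\ge\lambda_2\ge\cdots)\in\mathbb Y_N$ in Russian convention on the triangle $\{(j,k)\mid 0\le j\le k\le N\}$: the box in row $r\geq 0$ and column $c\geq 0$ lies at position $(c,N-r)$. The outer rim $\mathcal L_\lambda\subseteq\mathfrak X$ consists of the sites of the positions $(j,k)$ with $j\le\lambda_1\le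 k\le N$ that are not boxes of $\lambda$ and for which all positions $(j',k')$ with $0\le j'<j$, $k<k'\le N$ are boxes of $\lambda$. Then for each $\lambda\in\mathbb Y_N$ the system $\tilde f(L)=0$ $(L\in\mathcal L_\lambda)$, i.e. $f(j)+f(k)=d(j,k)$ for all $(j,k)\in\mathcal L_\lambda$, has a unique solution $f_\lambda\in\mathbb R^X$; it lies in $\operatorname{E}(X)$, and the $0$-faces of $\operatorname{E}(X)$ are precisely the sets $\{f_\lambda\}$, $\lambda\in\mathbb Y_N$. Moreover: 1. Whenever $\lambda\in\mathbb Y_N$ covers $\mu\in\mathbb Y_N$ in Young's lattice, $\lambda$ arises from $\mu$ by adding a box at a position $(j,k+1)$ of the triangle with $0\le j<k\le N-1$; for this position $(j,k+1)\in\mathcal L_\mu$ and $(j,k+1)\notin\mathcal L_\lambda$. The family $(f_\lambda)_{\lambda\in\mathbb Y_N}$ is the unique family of functions on $X$ that satisfies $f_{()}(l)=l(N-l)$ for the empty partition and, for all such $\lambda,\mu,j,k$, $$f_\lambda(l)=f_\mu(l)+\begin{cases}+1& (0\le l\le j),\\ -1&(j+1\le l\le k),\\ +1&(k+1\le l\le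 N-1).\end{cases}$$ 2. For $\lambda\in\mathbb Y_N$, padded by zero parts, put $\sigma(\lambda)=(\lambda_2+1,\dots,\lambda_{N-\lambda_1}+1)$, and let $\tau(\lambda)=(\sigma(\lambda'))'$, where $'$ is conjugation of partitions. Then $\sigma$ and $\tau$ map $\mathbb Y_N$ to itself and are inverse to each other; $\mathcal L_{\sigma(\lambda)}$ is the image of $\mathcal L_\lambda$ under the translation $(j,k)\mapsto(j+1,k+1)$ of $\mathfrak X$; for $\lambda=(\lambda_1,\dots,\lambda_m)\in\mathbb Y_N$ with $m$ nonzero parts, $\tau(\lambda)$ is $(N-m-1,\lambda_1-1,\dots,\lambda_m-1)$ with trailing zeros removed; and $f_\lambda(0)=|\lambda|$ and, for all $l\in X$, $$f_\lambda(l)=\bigl|\tau^l(\lambda)\bigr|.$$ -/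

import Mathlib

namespace InjHullYoung

section InjectiveHull

variable {X : Type*} [MetricSpace X]

/-- The extension `f̃` of `f : X → ℝ` to unordered pairs:
`f̃(j,k) = (f(j) + f(k) - d(j,k)) / 2`. -/
noncomputable def stripExt (f : X → ℝ) : Sym2 X → ℝ :=
  Sym2.lift ⟨fun j k => (f j + f k - dist j k) / 2, fun j k => by
    simp only [dist_comm j k, add_comm (f j) (f k)]⟩

variable (X) in
/-- The polyhedron `Δ(X)`. -/
def polyhedron : Set (X → ℝ) := {f | ∀ L : Sym2 X, 0 ≤ stripExt f L}

variable (X) in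
/-- The injective hull `E(X)` of a finite metric space `X`, as a subset of `ℝ^X`. -/
def injHull : Set (X → ℝ) :=
  {f | f ∈ polyhedron X ∧ ∀ j : X, ∃ L : Sym2 X, j ∈ L ∧ stripExt f L = 0}

variable (X) in
/-- The faces of `E(X)` as a polyhedral complex: the bounded (nonempty) faces of the
polyhedron `Δ(X)`.  A face of a polyhedron is the set of maximizers of a linear functional
(the zero functional gives the whole polyhedron). -/
def hullFaces [Fintype X] : Set (Set (X → ℝ)) :=
  {F | F.Nonempty ∧ IsExposed ℝ (polyhedron X) F ∧ Bornology.IsBounded F}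

variable (X) in
/-- The `v`-faces of `E(X)`: the faces whose affine span has dimension `v`. -/
def hullFacesOfDim [Fintype X] (v : ℕ) : Set (Set (X → ℝ)) :=
  {F | F ∈ hullFaces X ∧ Module.finrank ℝ (vectorSpan ℝ F) = v}

/-- The hyperplane `H_L = {f | f(j) + f(k) = d(j,k)}` for `L = (j,k)`, written as `f̃(L) = 0`. -/
def hyperplane (L : Sym2 X) : Set (X → ℝ) := {f | stripExt f L = 0}

/-- `H_𝓛`, the intersection of the `H_L` with `L ∈ 𝓛`. -/
def hyperplaneInter (S : Set (Sym2 X)) : Set (X → ℝ) := ⋂ L ∈ S, hyperplane L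

end InjectiveHull

section Circle

/-- The set `{0, …, N-1}`, to carry the metric `d(j,k) = |k-j| (N - |k-j|)`. -/
def Circ (N : ℕ) : Type := Fin N

instance (N : ℕ) : Fintype (Circ N) := inferInstanceAs (Fintype (Fin N))

/-- The number in `{0, …, N-1}`, as a real number. -/
def Circ.toReal {N : ℕ} (j : Circ N) : ℝ := ((j : Fin N).val : ℝ)

/-- `d(j,k) = |k-j| (N - |k-j|)`. -/
def circDist {N : ℕ} (j k : Circ N) : ℝ :=
  |k.toReal - j.toReal| * ((N : ℝ) - |k.toReal - j.toReal|)

theorem Circ.abs_sub_lt {N : ℕ} (j k : Circ N) : |k.toReal - j.toReal| < N := by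
  have hj : j.toReal < N := Nat.cast_lt.2 (j : Fin N).isLt
  have hk : k.toReal < N := Nat.cast_lt.2 (k : Fin N).isLt
  have hj0 : 0 ≤ j.toReal := Nat.cast_nonneg _
  have hk0 : 0 ≤ k.toReal := Nat.cast_nonneg _
  rw [abs_lt]
  constructor <;> linarith

theorem circDist_aux (n a b c : ℝ) (ha : 0 ≤ a) (hb : 0 ≤ b) (han : a ≤ n) (hbn : b ≤ n)
    (h : c = a + b ∨ c = a - b ∨ c = b - a) : c * (n - c) ≤ a * (n - a) + b * (n - b) := by
  rcases h with rfl | rfl | rfl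
  · nlinarith [mul_nonneg ha hb]
  · nlinarith [mul_nonneg hb (sub_nonneg.2 han)]
  · nlinarith [mul_nonneg ha (sub_nonneg.2 hbn)]

noncomputable instance (N : ℕ) : MetricSpace (Circ N) where
  dist j k := circDist j k
  dist_self j := by simp [circDist]
  dist_comm j k := by simp only [circDist, abs_sub_comm]
  dist_triangle i j k := by
    refine circDist_aux N |j.toReal - i.toReal| |k.toReal - j.toReal| |k.toReal - i.toReal|
      (abs_nonneg _) (abs_nonneg _) (Circ.abs_sub_lt _ _).le (Circ.abs_sub_lt _ _).le ?_
    rcases abs_cases (j.toReal - i.toReal) with h1 | h1 <;>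
    rcases abs_cases (k.toReal - j.toReal) with h2 | h2 <;>
    rcases abs_cases (k.toReal - i.toReal) with h3 | h3 <;>
    rw [h1.1, h2.1, h3.1] <;>
    first
    | (left; linarith)
    | (right; left; linarith)
    | (right; right; linarith)
  eq_of_dist_eq_zero {j k} h := by
    have h' : |k.toReal - j.toReal| * ((N : ℝ) - |k.toReal - j.toReal|) = 0 := h
    rcases mul_eq_zero.1 h' with h0 | h0
    · have h1 : k.toReal = j.toReal := sub_eq_zero.1 (abs_eq_zero.1 h0)
      exact Fin.ext (Nat.cast_injective (R := ℝ) h1.symm)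
    · exact absurd (sub_eq_zero.1 h0) (Circ.abs_sub_lt j k).ne'

variable (N : ℕ) [NeZero N]

/-- The point `j mod N` of the circle; in particular `N` is identified with `0`. -/
def pt (j : ℕ) : Circ N := Fin.ofNat N j

/-- The site `(j,k)` of the discrete Möbius strip `Sym2 (Circ N)`
(unordered pairs of points of the circle), with `N` identified with `0`. -/
def site (j k : ℕ) : Sym2 (Circ N) := s(pt N j, pt N k)

/-- The translation `j ↦ j + 1` of the circle. -/
def rotate (j : Circ N) : Circ N := pt N ((j : Fin N).val + 1)

end Circle

section Partitions

/-- Arm length plus leg length plus one; the cell `c = (i, j)` is in row `i` and column `j`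
(both counted from `0`). -/
def hookLength (ν : YoungDiagram) (c : ℕ × ℕ) : ℕ :=
  (ν.rowLen c.1 - (c.2 + 1)) + (ν.colLen c.2 - (c.1 + 1)) + 1

/-- `𝕐_N`: partitions all of whose hook lengths are `< N`. -/
def partitionsHookLT (N : ℕ) : Set YoungDiagram := {ν | ∀ c ∈ ν, hookLength ν c < N}

/-- The cell of a Young diagram drawn in Russian convention (bottom box at `(0,N)`) on the
triangle `{(j,k) | 0 ≤ j ≤ k ≤ N}` that lies at `(j,k)`: it is in row `N - k` and column `j`. -/
def cellAt (N j k : ℕ) : ℕ × ℕ := (N - k, j)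

/-- The outer rim `𝓛_ν` of `ν`. Draw `ν` in Russian convention on the triangle.
The rim runs from the left edge point `(0, ν₁)` to the right edge point `(ν₁, N)`, which is the
same site: it consists of the positions `(j,k)` with `j ≤ ν₁ ≤ k ≤ N` outside `ν` such that all
positions strictly below `(j,k)` in both directions are boxes of `ν`. -/
def outerRim (N : ℕ) [NeZero N] (ν : YoungDiagram) : Set (Sym2 (Circ N)) :=
  {L | ∃ j k : ℕ, j ≤ ν.rowLen 0 ∧ ν.rowLen 0 ≤ k ∧ k ≤ N ∧ cellAt N j k ∉ ν ∧
    (∀ j' k' : ℕ, j' < j → k < k' → k' ≤ N → cellAt N j' k' ∈ ν) ∧ L = site N j k}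

/-- `ν` is obtained from `μ` by adding the box at position `(j,k)` of the triangle. -/
def AddsBoxAt (N : ℕ) (μ ν : YoungDiagram) (j k : ℕ) : Prop :=
  cellAt N j k ∉ μ ∧ ν.cells = insert (cellAt N j k) μ.cells

/-- The recursive procedure for a family `g` of functions indexed by `𝕐_N`. -/
def ObeysRecursion (N : ℕ) (g : partitionsHookLT N → Circ N → ℝ) : Prop :=
  (∀ ν : partitionsHookLT N, (ν : YoungDiagram) = ⊥ →
    ∀ l : Circ N, g ν l = l.toReal * (N - l.toReal)) ∧
  (∀ μ ν : partitionsHookLT N, (μ : YoungDiagram) ⋖ (ν : YoungDiagram) →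
    ∀ j k : ℕ, j < k → k ≤ N - 1 → AddsBoxAt N μ ν j (k + 1) →
      ∀ l : Circ N, g ν l = g μ l +
        if (l : Fin N).val ≤ j then 1 else if (l : Fin N).val ≤ k then -1 else 1)

theorem sigmaRows_sorted (N : ℕ) (ν : YoungDiagram) :
    ((List.range (N - ν.rowLen 0 - 1)).map fun i => ν.rowLen (i + 1) + 1).SortedGE := by
  rw [List.sortedGE_iff_pairwise, List.pairwise_map]
  refine List.pairwise_lt_range.imp ?_
  intro a b hab
  have := ν.rowLen_anti (a + 1) (b + 1) (by omega)
  simp only [ge_iff_le]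
  omega

/-- Diagonal sliding: `σ(λ) = (λ₂ + 1, …, λ_{N-λ₁} + 1)`, where `λ` is padded by zeros. -/
def sigma (N : ℕ) (ν : YoungDiagram) : YoungDiagram :=
  YoungDiagram.ofRowLens
    ((List.range (N - ν.rowLen 0 - 1)).map fun i => ν.rowLen (i + 1) + 1)
    (sigmaRows_sorted N ν)

/-- `τ(λ) = (σ(λ'))'`, where `'` denotes the conjugate partition. -/
def tau (N : ℕ) (ν : YoungDiagram) : YoungDiagram := (sigma N ν.transpose).transpose

/-- The list `(N-m-1, λ₁-1, …, λ_m-1)` with trailing zeros removed, for `λ = (λ₁, …, λ_m)`. -/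
def tauRows (N : ℕ) (ν : YoungDiagram) : List ℕ :=
  ((N - ν.rowLens.length - 1) :: ν.rowLens.map (fun r => r - 1)).rdropWhile (fun r => r == 0)

end Partitions

end InjHullYoung

open InjHullYoung

namespace InjHullYoung

/-! ### Partitions with bounded hooks, diagonal sliding, covering relations -/

section Partitions

/-! The vertices have an explicit form. Unrolling the recursion, a box in row `r` and column `c`
contributes `-1` to the coordinates `l` with `c < l < N - r` and `+1` to the others; this gives
`vertexCoord`. For `c ≤ ν₁ ≤ N - r`, inclusion-exclusion (`vertexCoord_add_eq`) writes `f(c) + f(N -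
r) - d(c, N - r)` as twice the number of cells of the `r × c` rectangle missing from `ν` plus twice
the number of boxes weakly beyond `(r, c)`. Both counts are nonnegative and vanish on the outer rim,
so the vertex solves the rim equations; the pairs on one side of `ν₁` are estimated separately. The
solution is unique: along the rim the difference of two solutions is a constant on the coordinates
up to `ν₁` and its negative from `ν₁` on, and `ν₁` belongs to both sides.

Conversely, a `0`-face is a point that its tight equations determine. The metric forbids tight pairs
to be nested or disjoint, so the tight positions form a chain, and the cells strictly below it form
a partition. If some rim position of that partition were not tight, the chain would split there and
a step function with values `±1` would be a free direction (`IsRigid.not_splits`). Hence the point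
solves the rim equations.

Translation is an isometry that carries the rim of `ν` to that of `σ(ν)`, so by uniqueness it
carries vertices to vertices. Together with `f_ν(0) = |ν|` this gives all coordinates. -/

theorem mem_partitionsHookLT_iff {N : ℕ} [NeZero N] {ν : YoungDiagram} :
    ν ∈ partitionsHookLT N ↔ ν.rowLen 0 + ν.colLen 0 ≤ N := by
  constructor
  · intro h
    -- The corner hook is the longest; the empty diagram has no hook and needs `0 < N`.
    by_cases h0 : (0, 0) ∈ ν
    · have h1 := h _ h0
      have h2 := YoungDiagram.mem_iff_lt_rowLen.1 h0
      have h3 := YoungDiagram.mem_iff_lt_colLen.1 h0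
      simp only [hookLength] at h1
      omega
    · rw [YoungDiagram.mem_iff_lt_rowLen] at h0
      have h3 : ¬ 0 < ν.colLen 0 := by
        rwa [← YoungDiagram.mem_iff_lt_colLen, YoungDiagram.mem_iff_lt_rowLen]
      omega
  · rintro h ⟨i, j⟩ hc
    have h1 := YoungDiagram.mem_iff_lt_rowLen.1 hc
    have h2 := YoungDiagram.mem_iff_lt_colLen.1 hc
    have h3 := ν.rowLen_anti 0 i (Nat.zero_le _)
    have h4 := ν.colLen_anti 0 j (Nat.zero_le _)
    simp only [hookLength]
    omega

theorem lt_rowLen_zero_of_mem {ν : YoungDiagram} {r c : ℕ} (h : (r, c) ∈ ν) : c < ν.rowLen 0 :=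
  YoungDiagram.mem_iff_lt_rowLen.1 (ν.up_left_mem (Nat.zero_le r) le_rfl h)

theorem lt_colLen_zero_of_mem {ν : YoungDiagram} {r c : ℕ} (h : (r, c) ∈ ν) : r < ν.colLen 0 :=
  YoungDiagram.mem_iff_lt_colLen.1 (ν.up_left_mem le_rfl (Nat.zero_le c) h)

theorem row_add_rowLen_lt {N : ℕ} [NeZero N] {ν : YoungDiagram} (hν : ν ∈ partitionsHookLT N)
    {r c : ℕ} (h : (r, c) ∈ ν) : r + ν.rowLen 0 < N := by
  have := mem_partitionsHookLT_iff.1 hν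
  have := lt_colLen_zero_of_mem h
  omega

theorem col_add_colLen_lt {N : ℕ} [NeZero N] {ν : YoungDiagram} (hν : ν ∈ partitionsHookLT N)
    {r c : ℕ} (h : (r, c) ∈ ν) : c + ν.colLen 0 < N := by
  have := mem_partitionsHookLT_iff.1 hν
  have := lt_rowLen_zero_of_mem h
  omega

theorem rowLen_zero_lt {N : ℕ} [NeZero N] {ν : YoungDiagram} (hν : ν ∈ partitionsHookLT N) :
    ν.rowLen 0 < N := by
  by_cases h : (0, 0) ∈ ν
  · have := row_add_rowLen_lt hν h
    omega
  · rw [YoungDiagram.mem_iff_lt_rowLen] at h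
    have := NeZero.pos N
    omega

theorem partitionsHookLT_of_le {N : ℕ} [NeZero N] {μ ν : YoungDiagram} (h : μ ≤ ν)
    (hν : ν ∈ partitionsHookLT N) : μ ∈ partitionsHookLT N := by
  rw [mem_partitionsHookLT_iff] at hν ⊢
  have h1 : μ.rowLen 0 ≤ ν.rowLen 0 := by
    by_contra! hlt
    exact absurd (YoungDiagram.mem_iff_lt_rowLen.1 (h (YoungDiagram.mem_iff_lt_rowLen.2 hlt)))
      (lt_irrefl _)
  have h2 : μ.colLen 0 ≤ ν.colLen 0 := by
    by_contra! hlt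
    exact absurd (YoungDiagram.mem_iff_lt_colLen.1 (h (YoungDiagram.mem_iff_lt_colLen.2 hlt)))
      (lt_irrefl _)
  omega

theorem transpose_mem_partitionsHookLT {N : ℕ} [NeZero N] {ν : YoungDiagram}
    (hν : ν ∈ partitionsHookLT N) : ν.transpose ∈ partitionsHookLT N := by
  rw [mem_partitionsHookLT_iff] at hν ⊢
  rw [YoungDiagram.rowLen_transpose, YoungDiagram.colLen_transpose]
  omega

/-- `σ` drops row `0`, slides the other cells along the diagonal and fills a new column `0`. The
bound on `r` cuts off nothing else when `ν` is in `𝕐_N`. -/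
theorem mem_sigma {N : ℕ} {ν : YoungDiagram} {r c : ℕ} :
    (r, c) ∈ sigma N ν ↔ r + 1 + ν.rowLen 0 < N ∧ (c = 0 ∨ (r + 1, c - 1) ∈ ν) := by
  rw [sigma, YoungDiagram.mem_ofRowLens, YoungDiagram.mem_iff_lt_rowLen]
  simp only [List.length_map, List.length_range, List.getElem_map, List.getElem_range, exists_prop]
  omega

theorem mem_tau {N : ℕ} {ν : YoungDiagram} {r c : ℕ} :
    (r, c) ∈ tau N ν ↔ c + 1 + ν.colLen 0 < N ∧ (r = 0 ∨ (r - 1, c + 1) ∈ ν) := by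
  simp only [tau, YoungDiagram.mem_transpose, Prod.swap_prod_mk, mem_sigma,
    YoungDiagram.rowLen_transpose]

theorem rowLen_eq_of_forall {ν : YoungDiagram} {r n : ℕ} (h : ∀ c, (r, c) ∈ ν ↔ c < n) :
    ν.rowLen r = n := by
  refine eq_of_forall_lt_iff fun c => ?_
  rw [← YoungDiagram.mem_iff_lt_rowLen, h]

theorem colLen_eq_of_forall {ν : YoungDiagram} {c n : ℕ} (h : ∀ r, (r, c) ∈ ν ↔ r < n) :
    ν.colLen c = n := by
  refine eq_of_forall_lt_iff fun r => ?_
  rw [← YoungDiagram.mem_iff_lt_colLen, h]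

theorem colLen_sigma_zero (N : ℕ) (ν : YoungDiagram) :
    (sigma N ν).colLen 0 = N - ν.rowLen 0 - 1 := by
  refine colLen_eq_of_forall fun r => ?_
  rw [mem_sigma]
  omega

theorem rowLen_sigma_zero {N : ℕ} {ν : YoungDiagram} (h : ν.rowLen 0 + 1 < N) :
    (sigma N ν).rowLen 0 = ν.rowLen 1 + 1 := by
  refine rowLen_eq_of_forall fun c => ?_
  rw [mem_sigma, YoungDiagram.mem_iff_lt_rowLen, Nat.zero_add]
  omega

theorem rowLen_sigma_zero_le (N : ℕ) (ν : YoungDiagram) :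
    (sigma N ν).rowLen 0 ≤ ν.rowLen 1 + 1 := by
  by_contra! h
  have h1 := YoungDiagram.mem_iff_lt_rowLen.2 h
  rw [mem_sigma, YoungDiagram.mem_iff_lt_rowLen, Nat.zero_add] at h1
  omega

theorem mapsTo_sigma (N : ℕ) [NeZero N] :
    Set.MapsTo (sigma N) (partitionsHookLT N) (partitionsHookLT N) := by
  intro ν hν
  rw [mem_partitionsHookLT_iff, colLen_sigma_zero]
  have h1 := rowLen_sigma_zero_le N ν
  have h2 := ν.rowLen_anti 0 1 (Nat.zero_le _)
  have h3 := rowLen_zero_lt hν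
  omega

theorem mapsTo_tau (N : ℕ) [NeZero N] :
    Set.MapsTo (tau N) (partitionsHookLT N) (partitionsHookLT N) := fun _ hν =>
  transpose_mem_partitionsHookLT (mapsTo_sigma N (transpose_mem_partitionsHookLT hν))

theorem tau_sigma {N : ℕ} [NeZero N] {ν : YoungDiagram} (hν : ν ∈ partitionsHookLT N) :
    tau N (sigma N ν) = ν := by
  have h0 := rowLen_zero_lt hν
  refine SetLike.ext fun ⟨r, c⟩ => ?_
  rw [mem_tau, colLen_sigma_zero, mem_sigma]
  rcases Nat.eq_zero_or_pos r with rfl | hr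
  · rw [and_iff_left (Or.inl rfl), YoungDiagram.mem_iff_lt_rowLen]
    omega
  · rw [Nat.sub_add_cancel hr, Nat.add_sub_cancel]
    constructor
    · rintro ⟨h1, h2⟩
      rcases h2 with h2 | ⟨h2, h3 | h3⟩
      · omega
      · omega
      · exact h3
    · intro h
      have h1 := row_add_rowLen_lt hν h
      have h2 := lt_rowLen_zero_of_mem h
      exact ⟨by omega, Or.inr ⟨h1, Or.inr h⟩⟩

theorem sigma_tau {N : ℕ} [NeZero N] {ν : YoungDiagram} (hν : ν ∈ partitionsHookLT N) :
    sigma N (tau N ν) = ν := by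
  have h := tau_sigma (transpose_mem_partitionsHookLT hν)
  rw [tau] at h ⊢
  exact YoungDiagram.transpose_eq_iff.1 h

/-- Induction from the end of the list: a last entry `0` is dropped without changing the padded
sequence, while a nonzero last entry fixes the number of rows. -/
theorem rowLens_eq_rdropWhile {μ : YoungDiagram} (w : List ℕ)
    (h : ∀ i, w.getD i 0 = μ.rowLen i) : μ.rowLens = w.rdropWhile (fun r => r == 0) := by
  induction w using List.reverseRecOn with
  | nil =>
    have h0 : μ.colLen 0 = 0 := colLen_eq_of_forall fun r => by
      rw [YoungDiagram.mem_iff_lt_rowLen, ← h]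
      simp
    rw [List.rdropWhile_nil, ← List.length_eq_zero_iff, YoungDiagram.length_rowLens, h0]
  | append_singleton l x ih =>
    by_cases hx : x = 0
    · subst hx
      rw [List.rdropWhile_concat_pos _ _ _ (by simp)]
      refine ih fun i => ?_
      rw [← h]
      rcases lt_trichotomy i l.length with hi | rfl | hi
      · rw [List.getD_append _ _ _ _ hi]
      · simp
      · rw [List.getD_eq_default _ _ hi.le, List.getD_eq_default _ _ (by simp; omega)]
    · rw [List.rdropWhile_concat_neg _ _ _ (by simpa using hx)]
      have h1 : μ.colLen 0 = l.length + 1 := colLen_eq_of_forall fun r => by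
        rcases le_or_gt r l.length with hr | hr
        · have h2 := μ.rowLen_anti r l.length hr
          have h3 : μ.rowLen l.length = x := by rw [← h]; simp
          rw [YoungDiagram.mem_iff_lt_rowLen]
          omega
        · rw [YoungDiagram.mem_iff_lt_rowLen, ← h, List.getD_eq_default _ _ (by simp; omega)]
          omega
      refine List.ext_getElem (by simp [YoungDiagram.length_rowLens, h1]) fun i hi1 hi2 => ?_
      have h4 := h i
      rw [List.getD_eq_getElem _ _ hi2] at h4
      rw [h4]
      exact YoungDiagram.get_rowLens

theorem rowLens_tau {N : ℕ} [NeZero N] {ν : YoungDiagram} (hν : ν ∈ partitionsHookLT N) :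
    (tau N ν).rowLens = tauRows N ν := by
  refine rowLens_eq_rdropWhile _ fun i => ?_
  symm
  refine rowLen_eq_of_forall fun c => ?_
  rw [mem_tau]
  rcases i with _ | i
  · rw [List.getD_cons_zero, YoungDiagram.length_rowLens, and_iff_left (Or.inl rfl)]
    omega
  · have h1 : ((N - ν.rowLens.length - 1) :: ν.rowLens.map (fun r => r - 1)).getD (i + 1) 0 =
        ν.rowLen i - 1 := by
      rw [List.getD_cons_succ]
      rcases lt_or_ge i ν.rowLens.length with hi | hi
      · rw [List.getD_eq_getElem _ _ (by simpa using hi), List.getElem_map]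
        congr 1
        exact YoungDiagram.get_rowLens
      · rw [List.getD_eq_default _ _ (by simpa using hi)]
        rw [YoungDiagram.length_rowLens] at hi
        by_contra hne
        have h2 : (i, 0) ∈ ν := YoungDiagram.mem_iff_lt_rowLen.2 (by omega)
        have h3 := YoungDiagram.mem_iff_lt_colLen.1 h2
        omega
    rw [h1]
    constructor
    · rintro ⟨-, h | h⟩
      · omega
      · have := YoungDiagram.mem_iff_lt_rowLen.1 h
        simp only [Nat.add_sub_cancel] at this
        omega
    · intro h
      have h2 : (i, c + 1) ∈ ν := YoungDiagram.mem_iff_lt_rowLen.2 (by omega)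
      exact ⟨col_add_colLen_lt hν h2, Or.inr h2⟩

/-- A minimal cell of `ν \ μ` can be added to `μ`, since all cells below it already lie in `μ`. -/
theorem exists_insert_cells_le {μ ν : YoungDiagram} (h : μ < ν) :
    ∃ (c : ℕ × ℕ) (ρ : YoungDiagram), c ∉ μ ∧ ρ.cells = insert c μ.cells ∧ ρ ≤ ν := by
  have hne : (ν.cells \ μ.cells).Nonempty :=
    Finset.sdiff_nonempty.2 fun hsub => h.not_ge (YoungDiagram.cells_subset_iff.1 hsub)
  obtain ⟨c, hc⟩ := Finset.exists_minimal hne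
  obtain ⟨hcν, hcμ⟩ := Finset.mem_sdiff.1 hc.1
  refine ⟨c, ⟨insert c μ.cells, ?_⟩, hcμ, rfl, ?_⟩
  · intro a b hba ha
    rw [Finset.mem_coe, Finset.mem_insert] at ha ⊢
    rcases ha with rfl | ha
    · by_cases hb : b ∈ μ.cells
      · exact Or.inr hb
      · exact Or.inl (le_antisymm hba
          (hc.2 (Finset.mem_sdiff.2 ⟨ν.isLowerSet hba hcν, hb⟩) hba))
    · exact Or.inr (μ.isLowerSet hba ha)
  · exact Finset.insert_subset hcν (YoungDiagram.cells_subset_iff.2 h.le)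

theorem exists_cells_eq_insert_of_covBy {μ ν : YoungDiagram} (h : μ ⋖ ν) :
    ∃ c : ℕ × ℕ, c ∉ μ ∧ ν.cells = insert c μ.cells := by
  obtain ⟨c, ρ, hc, hρ, hle⟩ := exists_insert_cells_le h.lt
  have hlt : μ < ρ := by
    rw [← YoungDiagram.cells_ssubset_iff, hρ]
    exact Finset.ssubset_insert hc
  rcases hle.lt_or_eq with hlt' | rfl
  · exact absurd hlt' (h.2 hlt)
  · exact ⟨c, hc, hρ⟩

theorem exists_covBy {ν : YoungDiagram} (h : ν ≠ ⊥) : ∃ μ : YoungDiagram, μ ⋖ ν := by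
  have hne : ν.cells.Nonempty := by
    rw [Finset.nonempty_iff_ne_empty]
    intro h0
    exact h (YoungDiagram.ext h0)
  -- Removing a maximal cell leaves a diagram, and cardinality leaves no room for one in between.
  obtain ⟨c, hc⟩ := Finset.exists_maximal hne
  have hlow : IsLowerSet ((ν.cells.erase c : Finset (ℕ × ℕ)) : Set (ℕ × ℕ)) := by
    intro a b hba ha
    rw [Finset.mem_coe, Finset.mem_erase] at ha ⊢
    refine ⟨?_, ν.isLowerSet hba ha.2⟩
    rintro rfl
    exact ha.1 (le_antisymm (hc.2 ha.2 hba) hba)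
  refine ⟨⟨ν.cells.erase c, hlow⟩, ?_, fun ρ h1 h2 => ?_⟩
  · exact YoungDiagram.cells_ssubset_iff.1 (Finset.erase_ssubset hc.1)
  · rw [← YoungDiagram.cells_ssubset_iff] at h1 h2
    have h3 := Finset.card_lt_card h1
    have h4 := Finset.card_lt_card h2
    have h5 := Finset.card_erase_add_one hc.1
    simp only at h3
    omega

theorem exists_addsBoxAt_of_covBy {N : ℕ} [NeZero N] {μ ν : YoungDiagram}
    (hν : ν ∈ partitionsHookLT N) (h : μ ⋖ ν) :
    ∃ j k : ℕ, j < k ∧ k ≤ N - 1 ∧ AddsBoxAt N μ ν j (k + 1) := by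
  obtain ⟨⟨r, c⟩, hc, hins⟩ := exists_cells_eq_insert_of_covBy h
  have hmem : (r, c) ∈ ν := by
    rw [← YoungDiagram.mem_cells, hins]
    exact Finset.mem_insert_self _ _
  have h1 := row_add_rowLen_lt hν hmem
  have h2 := lt_rowLen_zero_of_mem hmem
  have h3 : cellAt N c (N - r - 1 + 1) = (r, c) := by
    rw [cellAt, Prod.mk.injEq]
    omega
  refine ⟨c, N - r - 1, by omega, by omega, ?_⟩
  rw [AddsBoxAt, h3]
  exact ⟨hc, hins⟩

end Partitions

/-! ### The outer rim and its translation -/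

section OuterRim

/-- The position with row coordinate `r` and column coordinate `c`, that is `(c, N - r)` in the
triangle, belongs to the outer rim of `ν`. -/
def IsRimCell (N : ℕ) (ν : YoungDiagram) (r c : ℕ) : Prop :=
  c ≤ ν.rowLen 0 ∧ r + ν.rowLen 0 ≤ N ∧ (r, c) ∉ ν ∧ (r = 0 ∨ c = 0 ∨ (r - 1, c - 1) ∈ ν)

theorem mem_outerRim_iff {N : ℕ} [NeZero N] {ν : YoungDiagram} {L : Sym2 (Circ N)} :
    L ∈ outerRim N ν ↔ ∃ r c, IsRimCell N ν r c ∧ L = site N c (N - r) := by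
  constructor
  · rintro ⟨j, k, h1, h2, h3, h4, h5, rfl⟩
    refine ⟨N - k, j, ⟨h1, by omega, h4, ?_⟩, by rw [Nat.sub_sub_self h3]⟩
    rcases Nat.eq_zero_or_pos j with hj | hj
    · exact Or.inr (Or.inl hj)
    rcases h3.eq_or_lt with hk | hk
    · exact Or.inl (by omega)
    have := h5 (j - 1) (k + 1) (by omega) (by omega) (by omega)
    rw [cellAt, ← Nat.sub_sub] at this
    exact Or.inr (Or.inr this)
  · rintro ⟨r, c, ⟨h1, h2, h3, h4⟩, rfl⟩
    refine ⟨c, N - r, h1, by omega, by omega, ?_, fun j' k' hj hk hk' => ?_, rfl⟩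
    · rwa [cellAt, Nat.sub_sub_self (by omega)]
    · rcases h4 with h4 | h4 | h4
      · omega
      · omega
      · exact ν.up_left_mem (by omega) (by omega) h4

theorem pt_eq_pt_iff {N : ℕ} [NeZero N] {a b : ℕ} (ha : a ≤ N) (hb : b ≤ N) :
    pt N a = pt N b ↔ a = b ∨ (a = 0 ∧ b = N) ∨ (a = N ∧ b = 0) := by
  have h0 := NeZero.pos N
  have h1 : pt N a = pt N b ↔ a % N = b % N := Fin.ext_iff
  rw [h1]
  rcases ha.lt_or_eq with ha | rfl <;> rcases hb.lt_or_eq with hb | rfl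
  · rw [Nat.mod_eq_of_lt ha, Nat.mod_eq_of_lt hb]
    omega
  · rw [Nat.mod_eq_of_lt ha, Nat.mod_self]
    omega
  · rw [Nat.mod_eq_of_lt hb, Nat.mod_self]
    omega
  · simp

theorem pt_self (N : ℕ) [NeZero N] : pt N N = pt N 0 :=
  (pt_eq_pt_iff le_rfl (Nat.zero_le _)).2 (Or.inr (Or.inr ⟨rfl, rfl⟩))

theorem rotate_pt (N : ℕ) [NeZero N] (j : ℕ) : rotate N (pt N j) = pt N (j + 1) :=
  Fin.ext (Nat.mod_add_mod j N 1)

theorem map_rotate_site (N : ℕ) [NeZero N] (j k : ℕ) :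
    Sym2.map (rotate N) (site N j k) = site N (j + 1) (k + 1) := by
  rw [site, Sym2.map_mk, rotate_pt, rotate_pt, site]

theorem site_self_right (N : ℕ) [NeZero N] (j : ℕ) : site N j N = site N 0 j := by
  rw [site, pt_self, site, Sym2.eq_swap]

theorem not_mem_of_le_row {N : ℕ} [NeZero N] {ν : YoungDiagram} (hν : ν ∈ partitionsHookLT N)
    {r : ℕ} (h : N ≤ r + ν.rowLen 0) (c : ℕ) : (r, c) ∉ ν := fun hc =>
  absurd (row_add_rowLen_lt hν hc) (by omega)

theorem isRimCell_zero_right {N : ℕ} [NeZero N] {ν : YoungDiagram} (hν : ν ∈ partitionsHookLT N) :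
    IsRimCell N ν (N - ν.rowLen 0) 0 := by
  have := rowLen_zero_lt hν
  exact ⟨Nat.zero_le _, by omega, not_mem_of_le_row hν (by omega) _, Or.inr (Or.inl rfl)⟩

theorem site_mem_outerRim_of_isRimCell {N : ℕ} [NeZero N] {ν : YoungDiagram} {r c : ℕ}
    (h : IsRimCell N ν r c) : site N c (N - r) ∈ outerRim N ν :=
  mem_outerRim_iff.2 ⟨r, c, h, rfl⟩

/-- The end of each column lies on the rim, so every coordinate up to `ν₁` occurs in a rim equation;
`isRimCell_rowLen` serves the coordinates from `ν₁` to `N`. -/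
theorem isRimCell_colLen {N : ℕ} [NeZero N] {ν : YoungDiagram} (hν : ν ∈ partitionsHookLT N)
    {c : ℕ} (hc : c ≤ ν.rowLen 0) : IsRimCell N ν (ν.colLen c) c := by
  have h1 := mem_partitionsHookLT_iff.1 hν
  have h2 := ν.colLen_anti 0 c (Nat.zero_le _)
  refine ⟨hc, by omega, by rw [YoungDiagram.mem_iff_lt_colLen]; omega, ?_⟩
  rcases Nat.eq_zero_or_pos (ν.colLen c) with h | h
  · exact Or.inl h
  · refine Or.inr (Or.inr (ν.up_left_mem le_rfl (Nat.sub_le c 1) ?_))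
    rw [YoungDiagram.mem_iff_lt_colLen]
    omega

theorem isRimCell_rowLen {N : ℕ} {ν : YoungDiagram}
    {r : ℕ} (hr : r + ν.rowLen 0 ≤ N) : IsRimCell N ν r (ν.rowLen r) := by
  have h2 := ν.rowLen_anti 0 r (Nat.zero_le _)
  refine ⟨h2, hr, by rw [YoungDiagram.mem_iff_lt_rowLen]; omega, ?_⟩
  rcases Nat.eq_zero_or_pos (ν.rowLen r) with h | h
  · exact Or.inr (Or.inl h)
  · refine Or.inr (Or.inr (ν.up_left_mem (Nat.sub_le r 1) le_rfl ?_))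
    rw [YoungDiagram.mem_iff_lt_rowLen]
    omega

/-- The only rim position in row `0` is the right edge point `(ν₁, N)`, which is the same site as
`(0, ν₁)`. With a positive row, translation stays in the triangle. -/
theorem exists_isRimCell_pos {N : ℕ} [NeZero N] {ν : YoungDiagram} (hν : ν ∈ partitionsHookLT N)
    {L : Sym2 (Circ N)} (hL : L ∈ outerRim N ν) :
    ∃ r c, IsRimCell N ν r c ∧ 0 < r ∧ L = site N c (N - r) := by
  obtain ⟨r, c, h, rfl⟩ := mem_outerRim_iff.1 hL
  rcases Nat.eq_zero_or_pos r with rfl | hr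
  · have h0 := rowLen_zero_lt hν
    obtain ⟨h1, -, h3, -⟩ := h
    rw [YoungDiagram.mem_iff_lt_rowLen] at h3
    refine ⟨_, _, isRimCell_zero_right hν, by omega, ?_⟩
    rw [Nat.sub_zero, site_self_right, Nat.sub_sub_self h0.le]
    congr 1
    omega
  · exact ⟨r, c, h, hr, rfl⟩

theorem outerRim_sigma_subset {N : ℕ} [NeZero N] {ν : YoungDiagram}
    (hν : ν ∈ partitionsHookLT N) :
    outerRim N (sigma N ν) ⊆ Sym2.map (rotate N) '' outerRim N ν := by
  intro L hL
  obtain ⟨r, c, ⟨h1, h2, h3, h4⟩, rfl⟩ := mem_outerRim_iff.1 hL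
  have h0 := rowLen_zero_lt hν
  have hle := rowLen_sigma_zero_le N ν
  have hanti := ν.rowLen_anti 0 1 (Nat.zero_le _)
  rw [mem_sigma] at h3
  rw [mem_sigma] at h4
  rcases Nat.eq_zero_or_pos c with rfl | hc
  · have hlen : ν.rowLen 0 + 1 < N → (sigma N ν).rowLen 0 = ν.rowLen 1 + 1 := rowLen_sigma_zero
    have h1N : N ≤ ν.rowLen 0 + 1 → ν.rowLen 1 = 0 := fun h => by
      by_contra hne
      exact not_mem_of_le_row hν (r := 1) (by omega) 0
        (YoungDiagram.mem_iff_lt_rowLen.2 (by omega))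
    have hrow : ν.rowLen 1 ≤ N - r - 1 := by omega
    have hrow0 : N ≤ ν.rowLen 0 + 1 + r := by omega
    -- A site `(0, N - r)` on the left edge is reread on the right edge as `(j + 1, N)`, the
    -- translate of `(j, N - 1)` in row `1`. For `r = N` it is the site of `(N, N)`, whence `j = N -
    -- 1`.
    obtain ⟨j, hj0, hj1, hj⟩ : ∃ j, j ≤ ν.rowLen 0 ∧ ν.rowLen 1 ≤ j ∧
        site N 0 (N - r) = site N (j + 1) N := by
      rcases (by omega : r ≤ N).lt_or_eq with hr | hr
      · refine ⟨N - r - 1, by omega, by omega, ?_⟩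
        rw [Nat.sub_add_cancel (by omega : 1 ≤ N - r), site_self_right]
      · refine ⟨N - 1, by omega, by omega, ?_⟩
        rw [Nat.sub_add_cancel (by omega : 1 ≤ N), site_self_right, site, site, hr, pt_self,
          Nat.sub_self]
    refine ⟨site N j (N - 1), site_mem_outerRim_of_isRimCell ⟨hj0, by omega, ?_, ?_⟩, ?_⟩
    · rw [YoungDiagram.mem_iff_lt_rowLen]
      omega
    · rw [YoungDiagram.mem_iff_lt_rowLen]
      simp only [Nat.sub_self]
      omega
    · rw [map_rotate_site, Nat.sub_add_cancel (by omega : 1 ≤ N), hj]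
  · have hr : r + 1 + ν.rowLen 0 ≤ N := by
      rcases h4 with h4 | h4 | h4 <;> omega
    refine ⟨site N (c - 1) (N - (r + 1)),
      site_mem_outerRim_of_isRimCell ⟨by omega, hr, ?_, ?_⟩, ?_⟩
    · intro hmem
      exact h3 ⟨row_add_rowLen_lt hν hmem, Or.inr hmem⟩
    · rw [Nat.add_sub_cancel]
      rcases h4 with rfl | h4 | ⟨h4, h5⟩
      · refine Or.inr ?_
        rw [YoungDiagram.mem_iff_lt_rowLen]
        omega
      · omega
      · rcases h5 with h5 | h5
        · exact Or.inr (Or.inl h5)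
        · by_cases hr0 : r = 0
          · subst hr0
            refine Or.inr (Or.inr (ν.up_left_mem (Nat.zero_le _) le_rfl h5))
          · rw [Nat.sub_add_cancel (by omega)] at h5
            exact Or.inr (Or.inr h5)
    · rw [map_rotate_site]
      congr 1 <;> omega

theorem image_rotate_outerRim_subset {N : ℕ} [NeZero N] {ν : YoungDiagram}
    (hν : ν ∈ partitionsHookLT N) :
    Sym2.map (rotate N) '' outerRim N ν ⊆ outerRim N (sigma N ν) := by
  rintro _ ⟨L, hL, rfl⟩
  obtain ⟨r, c, ⟨h1, h2, h3, h4⟩, hr, rfl⟩ := exists_isRimCell_pos hν hL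
  have h0 := rowLen_zero_lt hν
  have hle := rowLen_sigma_zero_le N ν
  have hanti := ν.rowLen_anti 0 1 (Nat.zero_le _)
  rw [map_rotate_site, show N - r + 1 = N - (r - 1) by omega]
  obtain rfl | hr1 : r = 1 ∨ 1 < r := by omega
  -- Row `1` is translated onto the right edge, which is reread as the left edge.
  · rw [YoungDiagram.mem_iff_lt_rowLen] at h3
    rw [Nat.sub_self, Nat.sub_zero, site_self_right,
      show c + 1 = N - (N - (c + 1)) by omega]
    refine site_mem_outerRim_of_isRimCell ⟨Nat.zero_le _, by omega, ?_, Or.inr (Or.inl rfl)⟩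
    rw [mem_sigma]
    omega
  · have hc : c ≤ ν.rowLen 1 := by
      rcases h4 with h4 | h4 | h4
      · omega
      · omega
      · have := YoungDiagram.mem_iff_lt_rowLen.1 h4
        have := ν.rowLen_anti 1 (r - 1) (by omega)
        omega
    have hlen := rowLen_sigma_zero (N := N) (ν := ν) (by omega)
    refine site_mem_outerRim_of_isRimCell ⟨by omega, by omega, ?_, Or.inr (Or.inr ?_)⟩
    · rw [mem_sigma, Nat.add_sub_cancel, Nat.sub_add_cancel hr]
      rintro ⟨-, h | h⟩
      · omega
      · exact h3 h
    · rw [mem_sigma, Nat.add_sub_cancel, Nat.sub_add_cancel (by omega)]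
      refine ⟨by omega, ?_⟩
      rcases h4 with h4 | h4 | h4
      · omega
      · exact Or.inl h4
      · exact Or.inr h4

theorem outerRim_sigma {N : ℕ} [NeZero N] {ν : YoungDiagram} (hν : ν ∈ partitionsHookLT N) :
    outerRim N (sigma N ν) = Sym2.map (rotate N) '' outerRim N ν :=
  (outerRim_sigma_subset hν).antisymm (image_rotate_outerRim_subset hν)

theorem site_mem_outerRim_of_addsBoxAt {N : ℕ} [NeZero N] {μ ν : YoungDiagram}
    (hν : ν ∈ partitionsHookLT N) {j k : ℕ} (hk : k ≤ N - 1)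
    (h : AddsBoxAt N μ ν j (k + 1)) :
    site N j (k + 1) ∈ outerRim N μ ∧ site N j (k + 1) ∉ outerRim N ν := by
  obtain ⟨hμ, hins⟩ := h
  have hN := NeZero.pos N
  have hmem : ∀ x, x ∈ ν ↔ x = cellAt N j (k + 1) ∨ x ∈ μ := fun x => by
    rw [← YoungDiagram.mem_cells, hins, Finset.mem_insert, YoungDiagram.mem_cells]
  have hbox : (N - (k + 1), j) ∈ ν := (hmem _).2 (Or.inl rfl)
  have h1 := row_add_rowLen_lt hν hbox
  have h2 := lt_rowLen_zero_of_mem hbox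
  have hlt : ∀ r c, r ≤ N - (k + 1) → c ≤ j → (r, c) ≠ (N - (k + 1), j) → (r, c) ∈ μ :=
    fun r c hr hc hne => ((hmem _).1 (ν.up_left_mem hr hc hbox)).resolve_left hne
  constructor
  · refine ⟨j, k + 1, ?_, ?_, by omega, hμ, ?_, rfl⟩
    · rcases Nat.eq_zero_or_pos j with rfl | hj
      · exact Nat.zero_le _
      · have := lt_rowLen_zero_of_mem (hlt (N - (k + 1)) (j - 1) le_rfl (Nat.sub_le _ _)
          (by rw [Ne, Prod.mk.injEq]; omega))
        omega
    · by_contra! hlt'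
      have h3 := lt_rowLen_zero_of_mem
        ((hmem _).2 (Or.inr (YoungDiagram.mem_iff_lt_rowLen.2 hlt')))
      omega
    · intro j' k' hj hk' hkN
      exact hlt _ _ (by omega) hj.le (by rw [Ne, Prod.mk.injEq]; omega)
  · rintro ⟨a, b, ha, hb, hbN, hab, -, heq⟩
    -- As the box lies in `ν`, `j < ν₁ < k + 1`; of the boundary identifications only the exchange
    -- of the two ends of `(0, N)` survives.
    have hcell : a = j ∧ b = k + 1 ∨ a = 0 ∧ b = N := by
      rw [site, site, Sym2.eq_iff, pt_eq_pt_iff (by omega) (by omega),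
        pt_eq_pt_iff (by omega) (by omega), pt_eq_pt_iff (by omega) (by omega),
        pt_eq_pt_iff (by omega) (by omega)] at heq
      omega
    rcases hcell with ⟨rfl, rfl⟩ | ⟨rfl, rfl⟩
    · exact hab hbox
    · refine hab ?_
      rw [cellAt, Nat.sub_self]
      exact ν.up_left_mem (Nat.zero_le _) (Nat.zero_le _) hbox

end OuterRim

/-! ### Uniqueness and explicit form of the vertices -/

section Vertices

theorem toReal_pt {N : ℕ} [NeZero N] {j : ℕ} (hj : j < N) : (pt N j).toReal = j :=
  congrArg Nat.cast (Nat.mod_eq_of_lt hj)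

theorem pt_val {N : ℕ} [NeZero N] (l : Circ N) : pt N (l : Fin N).val = l :=
  Fin.ext (Nat.mod_eq_of_lt (l : Fin N).isLt)

theorem exists_pt {N : ℕ} [NeZero N] (l : Circ N) : ∃ j < N, l = pt N j :=
  ⟨(l : Fin N).val, (l : Fin N).isLt, (pt_val l).symm⟩

theorem dist_pt {N : ℕ} [NeZero N] {j k : ℕ} (hjk : j ≤ k) (hk : k ≤ N) :
    dist (pt N j) (pt N k) = ((k : ℝ) - j) * (N - (k - j)) := by
  change circDist _ _ = _
  have h0 := NeZero.pos N
  rcases hk.lt_or_eq with hk | rfl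
  · have h : (j : ℝ) ≤ k := Nat.cast_le.2 hjk
    rw [circDist, toReal_pt hk, toReal_pt (hjk.trans_lt hk), abs_of_nonneg (sub_nonneg.2 h)]
  · rcases hjk.lt_or_eq with hj | rfl
    · rw [circDist, pt_self, toReal_pt hj, toReal_pt h0, Nat.cast_zero, zero_sub, abs_neg,
        Nat.abs_cast]
      ring
    · simp [circDist]

theorem stripExt_site {N : ℕ} [NeZero N] (f : Circ N → ℝ) {j k : ℕ} (hjk : j ≤ k) (hk : k ≤ N) :
    stripExt f (site N j k) =
      (f (pt N j) + f (pt N k) - ((k : ℝ) - j) * (N - (k - j))) / 2 := by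
  rw [← dist_pt hjk hk]
  rfl

theorem exists_site {N : ℕ} [NeZero N] (L : Sym2 (Circ N)) :
    ∃ j k, j ≤ k ∧ k < N ∧ L = site N j k := by
  induction L using Sym2.ind with
  | _ x y =>
    obtain ⟨j, hj, rfl⟩ := exists_pt x
    obtain ⟨k, hk, rfl⟩ := exists_pt y
    rcases le_total j k with h | h
    · exact ⟨j, k, h, hk, rfl⟩
    · exact ⟨k, j, h, hj, Sym2.eq_swap⟩

theorem mem_polyhedron_iff {N : ℕ} [NeZero N] {f : Circ N → ℝ} :
    f ∈ polyhedron (Circ N) ↔ ∀ j k : ℕ, j ≤ k → k ≤ N →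
      ((k : ℝ) - j) * (N - (k - j)) ≤ f (pt N j) + f (pt N k) := by
  constructor
  · intro h j k hjk hk
    have := h (site N j k)
    rw [stripExt_site f hjk hk] at this
    linarith
  · intro h L
    obtain ⟨j, k, hjk, hk, rfl⟩ := exists_site L
    rw [stripExt_site f hjk hk.le]
    linarith [h j k hjk hk.le]

theorem mem_hyperplaneInter {X : Type*} [MetricSpace X] {f : X → ℝ} {S : Set (Sym2 X)} :
    f ∈ hyperplaneInter S ↔ ∀ L ∈ S, stripExt f L = 0 := by
  simp only [hyperplaneInter, hyperplane, Set.mem_iInter, Set.mem_ofPred_eq]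

theorem mem_hyperplaneInter_outerRim {N : ℕ} [NeZero N] {f : Circ N → ℝ} {ν : YoungDiagram} :
    f ∈ hyperplaneInter (outerRim N ν) ↔ ∀ r c : ℕ, IsRimCell N ν r c →
      f (pt N c) + f (pt N (N - r)) = ((N : ℝ) - r - c) * (r + c) := by
  have key : ∀ r c, IsRimCell N ν r c → stripExt f (site N c (N - r)) =
      (f (pt N c) + f (pt N (N - r)) - ((N : ℝ) - r - c) * (r + c)) / 2 := by
    intro r c h
    have h1 := h.1
    have h2 := h.2.1
    rw [stripExt_site f (by omega) (Nat.sub_le _ _), Nat.cast_sub (by omega)]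
    ring
  rw [mem_hyperplaneInter]
  constructor
  · intro h r c hrc
    have := h _ (site_mem_outerRim_of_isRimCell hrc)
    rw [key r c hrc] at this
    linarith
  · intro h L hL
    obtain ⟨r, c, hrc, rfl⟩ := mem_outerRim_iff.1 hL
    rw [key r c hrc, h r c hrc, sub_self, zero_div]

theorem subsingleton_hyperplaneInter_outerRim {N : ℕ} [NeZero N] {ν : YoungDiagram}
    (hν : ν ∈ partitionsHookLT N) : (hyperplaneInter (outerRim N ν)).Subsingleton := by
  intro f hf g hg
  rw [mem_hyperplaneInter_outerRim] at hf hg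
  have hrim : ∀ r c, IsRimCell N ν r c →
      f (pt N c) - g (pt N c) = -(f (pt N (N - r)) - g (pt N (N - r))) := fun r c h => by
    linarith [hf r c h, hg r c h]
  set p := ν.rowLen 0 with hp
  have h0 := rowLen_zero_lt hν
  have hcol : ∀ c, c ≤ p → f (pt N c) - g (pt N c) = f (pt N p) - g (pt N p) := by
    intro c hc
    induction hc using Nat.decreasingInduction with
    | self => rfl
    | of_succ c hc ih =>
      have hc' : c < p := hc
      have h1 : 0 < ν.colLen c := by
        rw [← YoungDiagram.mem_iff_lt_colLen, YoungDiagram.mem_iff_lt_rowLen]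
        exact hc'
      have h2 := isRimCell_colLen hν hc'.le
      -- Columns `c` and `c + 1` both meet the rim in row `ν.colLen c`, so their deviations agree.
      have h3 : IsRimCell N ν (ν.colLen c) (c + 1) := by
        refine ⟨hc', h2.2.1, fun h => h2.2.2.1 (ν.up_left_mem le_rfl (Nat.le_succ c) h),
          Or.inr (Or.inr ?_)⟩
        rw [Nat.add_sub_cancel, YoungDiagram.mem_iff_lt_colLen]
        omega
      rw [← ih, hrim _ _ h2, hrim _ _ h3]
  have hrow : ∀ r, r + p ≤ N →
      f (pt N (N - r)) - g (pt N (N - r)) = -(f (pt N p) - g (pt N p)) := by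
    intro r hr
    have h1 := isRimCell_rowLen (ν := ν) hr
    rw [← hcol _ h1.1, hrim _ _ h1, neg_neg]
  -- The coordinate `p` is also the row coordinate `N - (N - p)`, so its deviation is its own
  -- negative.
  have hzero : f (pt N p) - g (pt N p) = 0 := by
    have h1 := hrow (N - p) (by omega)
    rw [Nat.sub_sub_self h0.le] at h1
    linarith
  funext l
  obtain ⟨j, hj, rfl⟩ := exists_pt l
  rcases le_total j p with h | h
  · linarith [hcol j h]
  · have h1 := hrow (N - j) (by omega)
    rw [Nat.sub_sub_self hj.le] at h1
    linarith

/-- The coordinates of the vertex that belongs to `ν`, with a redundant coordinate `N`. -/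
noncomputable def vertexCoord (N : ℕ) (ν : YoungDiagram) (l : ℕ) : ℝ :=
  l * (N - l) + ν.card - 2 * ((ν.cells.filter fun x => x.2 < l ∧ x.1 + l < N).card : ℝ)

/-- The vertex of the injective hull that belongs to `ν`. -/
noncomputable def vertex (N : ℕ) (ν : YoungDiagram) (l : Circ N) : ℝ :=
  vertexCoord N ν (l : Fin N).val

theorem vertexCoord_zero (N : ℕ) (ν : YoungDiagram) : vertexCoord N ν 0 = ν.card := by
  simp [vertexCoord]

theorem vertexCoord_self (N : ℕ) (ν : YoungDiagram) : vertexCoord N ν N = ν.card := by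
  simp [vertexCoord]

theorem vertex_pt {N : ℕ} [NeZero N] (ν : YoungDiagram) {j : ℕ} (hj : j ≤ N) :
    vertex N ν (pt N j) = vertexCoord N ν j := by
  have h : vertex N ν (pt N j) = vertexCoord N ν (j % N) := rfl
  rw [h]
  rcases hj.lt_or_eq with hj | rfl
  · rw [Nat.mod_eq_of_lt hj]
  · rw [Nat.mod_self, vertexCoord_zero, vertexCoord_self]

theorem vertexCoord_of_le {N : ℕ} [NeZero N] {ν : YoungDiagram} (hν : ν ∈ partitionsHookLT N)
    {l : ℕ} (hl : l ≤ ν.rowLen 0) : vertexCoord N ν l =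
      l * (N - l) + ν.card - 2 * ((ν.cells.filter fun x => x.2 < l).card : ℝ) := by
  have h : (ν.cells.filter fun x => x.2 < l ∧ x.1 + l < N) = ν.cells.filter fun x => x.2 < l := by
    refine Finset.filter_congr fun ⟨r, c⟩ hx => ?_
    have := row_add_rowLen_lt hν hx
    simp only
    omega
  rw [vertexCoord, h]

theorem vertexCoord_of_ge {N : ℕ} {ν : YoungDiagram}
    {l : ℕ} (hl : ν.rowLen 0 ≤ l) : vertexCoord N ν l =
      l * (N - l) + ν.card - 2 * ((ν.cells.filter fun x => x.1 < N - l).card : ℝ) := by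
  have h : (ν.cells.filter fun x => x.2 < l ∧ x.1 + l < N) =
      ν.cells.filter fun x => x.1 < N - l := by
    refine Finset.filter_congr fun ⟨r, c⟩ hx => ?_
    have := lt_rowLen_zero_of_mem hx
    simp only
    omega
  rw [vertexCoord, h]

theorem vertexCoord_add_eq {N : ℕ} [NeZero N] {ν : YoungDiagram} (hν : ν ∈ partitionsHookLT N)
    {r c : ℕ} (hc : c ≤ ν.rowLen 0) (hr : r + ν.rowLen 0 ≤ N) :
    vertexCoord N ν c + vertexCoord N ν (N - r) = ((N : ℝ) - r - c) * (r + c) +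
      2 * ((r : ℝ) * c - ((ν.cells.filter fun x => x.1 < r ∧ x.2 < c).card : ℝ)) +
      2 * ((ν.cells.filter fun x => r ≤ x.1 ∧ c ≤ x.2).card : ℝ) := by
  rw [vertexCoord_of_le hν hc, vertexCoord_of_ge (by omega : ν.rowLen 0 ≤ N - r),
    Nat.sub_sub_self (by omega), Nat.cast_sub (by omega)]
  have h1 := Finset.card_filter_add_card_filter_not (s := ν.cells) (fun x => x.1 < r)
  have h2 := Finset.card_filter_add_card_filter_not
    (s := ν.cells.filter fun x => x.2 < c) (fun x => x.1 < r)
  have h3 := Finset.card_filter_add_card_filter_not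
    (s := ν.cells.filter fun x => ¬ x.1 < r) (fun x => x.2 < c)
  simp only [Finset.filter_filter, not_lt] at h1 h2 h3
  simp only [and_comm (a := _ < c) (b := _ < r), and_comm (a := _ < c) (b := r ≤ _)] at h2
  -- Inclusion-exclusion for the first `r` rows and the first `c` columns.
  have h : ν.card + (ν.cells.filter fun x => x.1 < r ∧ x.2 < c).card =
      (ν.cells.filter fun x => x.2 < c).card + (ν.cells.filter fun x => x.1 < r).card +
        (ν.cells.filter fun x => r ≤ x.1 ∧ c ≤ x.2).card := by
    rw [YoungDiagram.card]
    omega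
  have h' := congrArg (Nat.cast (R := ℝ)) h
  push_cast at h'
  linear_combination 2 * h'

theorem card_filter_lt_lt_le (ν : YoungDiagram) (r c : ℕ) :
    (ν.cells.filter fun x => x.1 < r ∧ x.2 < c).card ≤ r * c := by
  calc _ ≤ (Finset.range r ×ˢ Finset.range c).card := Finset.card_le_card fun x hx => by
        simpa using (Finset.mem_filter.1 hx).2
    _ = r * c := by simp

theorem card_filter_lt_lt_of_mem {ν : YoungDiagram} {r c : ℕ} (h : (r - 1, c - 1) ∈ ν) :
    (ν.cells.filter fun x => x.1 < r ∧ x.2 < c).card = r * c := by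
  refine (card_filter_lt_lt_le ν r c).antisymm ?_
  calc r * c = (Finset.range r ×ˢ Finset.range c).card := by simp
    _ ≤ _ := Finset.card_le_card fun x hx => by
        rw [Finset.mem_product, Finset.mem_range, Finset.mem_range] at hx
        exact Finset.mem_filter.2 ⟨ν.up_left_mem (by omega) (by omega) h, hx⟩

theorem le_vertexCoord_add {N : ℕ} [NeZero N] {ν : YoungDiagram} (hν : ν ∈ partitionsHookLT N)
    {r c : ℕ} (hc : c ≤ ν.rowLen 0) (hr : r + ν.rowLen 0 ≤ N) :
    ((N : ℝ) - r - c) * (r + c) ≤ vertexCoord N ν c + vertexCoord N ν (N - r) := by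
  rw [vertexCoord_add_eq hν hc hr]
  have h1 : ((ν.cells.filter fun x => x.1 < r ∧ x.2 < c).card : ℝ) ≤ r * c := by
    exact_mod_cast card_filter_lt_lt_le ν r c
  have h2 : (0 : ℝ) ≤ ((ν.cells.filter fun x => r ≤ x.1 ∧ c ≤ x.2).card : ℝ) := Nat.cast_nonneg _
  linarith

theorem vertex_mem_hyperplaneInter {N : ℕ} [NeZero N] {ν : YoungDiagram}
    (hν : ν ∈ partitionsHookLT N) : vertex N ν ∈ hyperplaneInter (outerRim N ν) := by
  rw [mem_hyperplaneInter_outerRim]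
  rintro r c ⟨h1, h2, h3, h4⟩
  rw [vertex_pt ν (by omega), vertex_pt ν (Nat.sub_le _ _), vertexCoord_add_eq hν h1 h2]
  have h5 : (ν.cells.filter fun x => r ≤ x.1 ∧ c ≤ x.2) = ∅ :=
    Finset.filter_eq_empty_iff.2 fun _ hx h => h3 (ν.up_left_mem h.1 h.2 hx)
  have h6 : (ν.cells.filter fun x => x.1 < r ∧ x.2 < c).card = r * c := by
    rcases h4 with rfl | rfl | h4
    · simp
    · simp
    · exact card_filter_lt_lt_of_mem h4
  rw [h5, h6, Finset.card_empty]
  push_cast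
  ring

theorem hyperplaneInter_outerRim {N : ℕ} [NeZero N] {ν : YoungDiagram}
    (hν : ν ∈ partitionsHookLT N) : hyperplaneInter (outerRim N ν) = {vertex N ν} :=
  (subsingleton_hyperplaneInter_outerRim hν).eq_singleton_of_mem (vertex_mem_hyperplaneInter hν)

theorem vertex_mem_polyhedron {N : ℕ} [NeZero N] {ν : YoungDiagram}
    (hν : ν ∈ partitionsHookLT N) : vertex N ν ∈ polyhedron (Circ N) := by
  rw [mem_polyhedron_iff]
  intro j k hjk hk
  rw [vertex_pt ν (hjk.trans hk), vertex_pt ν hk]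
  have h0 := rowLen_zero_lt hν
  have hjk' : (j : ℝ) ≤ k := Nat.cast_le.2 hjk
  have hk' : (k : ℝ) ≤ N := Nat.cast_le.2 hk
  rcases le_total k (ν.rowLen 0) with h | h
  · have h1 := le_vertexCoord_add hν (r := 0) h (by omega)
    rw [Nat.sub_zero, vertexCoord_self, vertexCoord_of_le hν h] at h1
    rw [vertexCoord_of_le hν h, vertexCoord_of_le hν (hjk.trans h)]
    have h2 : (ν.cells.filter fun x => x.2 < j).card ≤ (N - k) * j := by
      refine le_trans (Finset.card_le_card fun x hx => ?_) (card_filter_lt_lt_le ν (N - k) j)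
      obtain ⟨hx1, hx2⟩ := Finset.mem_filter.1 hx
      have := row_add_rowLen_lt hν (r := x.1) (c := x.2) hx1
      exact Finset.mem_filter.2 ⟨hx1, by omega, hx2⟩
    have h3 : ((ν.cells.filter fun x => x.2 < j).card : ℝ) ≤ (N - k) * j := by
      rw [← Nat.cast_sub hk]
      exact_mod_cast h2
    push_cast at h1
    linarith
  · rcases le_total (ν.rowLen 0) j with h' | h'
    · have h1 := le_vertexCoord_add hν (r := N - j) (Nat.zero_le _) (by omega)
      rw [vertexCoord_zero, Nat.sub_sub_self (by omega), vertexCoord_of_ge h',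
        Nat.cast_sub (by omega)] at h1
      rw [vertexCoord_of_ge h, vertexCoord_of_ge h']
      have h2 : (ν.cells.filter fun x => x.1 < N - k).card ≤ (N - k) * j := by
        refine le_trans (Finset.card_le_card fun x hx => ?_) (card_filter_lt_lt_le ν (N - k) j)
        obtain ⟨hx1, hx2⟩ := Finset.mem_filter.1 hx
        have := lt_rowLen_zero_of_mem (r := x.1) (c := x.2) hx1
        exact Finset.mem_filter.2 ⟨hx1, hx2, by omega⟩
      have h3 : ((ν.cells.filter fun x => x.1 < N - k).card : ℝ) ≤ (N - k) * j := by
        rw [← Nat.cast_sub hk]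
        exact_mod_cast h2
      push_cast at h1
      linarith
    · have h1 := le_vertexCoord_add hν (r := N - k) h' (by omega)
      rw [Nat.sub_sub_self hk, Nat.cast_sub hk] at h1
      linarith

theorem vertex_mem_injHull {N : ℕ} [NeZero N] {ν : YoungDiagram}
    (hν : ν ∈ partitionsHookLT N) : vertex N ν ∈ injHull (Circ N) := by
  refine ⟨vertex_mem_polyhedron hν, fun l => ?_⟩
  have key := mem_hyperplaneInter.1 (vertex_mem_hyperplaneInter hν)
  obtain ⟨j, hj, rfl⟩ := exists_pt l
  rcases le_total j (ν.rowLen 0) with h | h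
  · exact ⟨_, Sym2.mem_mk_left _ _, key _ (site_mem_outerRim_of_isRimCell (isRimCell_colLen hν h))⟩
  · have h1 := site_mem_outerRim_of_isRimCell
      (isRimCell_rowLen (N := N) (ν := ν) (r := N - j) (by omega))
    rw [Nat.sub_sub_self hj.le] at h1
    exact ⟨_, Sym2.mem_mk_right _ _, key _ h1⟩

end Vertices

/-! ### Adding a box, and rotation of vertices -/

section Recursion

theorem vertexCoord_eq_add_of_addsBoxAt {N : ℕ} {μ ν : YoungDiagram} {j k l : ℕ}
    (hl : l < N) (h : AddsBoxAt N μ ν j (k + 1)) :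
    vertexCoord N ν l = vertexCoord N μ l + if l ≤ j then 1 else if l ≤ k then -1 else 1 := by
  obtain ⟨hμ, hins⟩ := h
  have hbox : cellAt N j (k + 1) ∉ μ.cells := hμ
  rw [vertexCoord, vertexCoord, YoungDiagram.card, YoungDiagram.card, hins,
    Finset.card_insert_of_notMem hbox, Finset.filter_insert]
  have hiff : (cellAt N j (k + 1)).2 < l ∧ (cellAt N j (k + 1)).1 + l < N ↔ j < l ∧ l ≤ k := by
    simp only [cellAt]
    omega
  by_cases h1 : j < l ∧ l ≤ k
  · rw [if_pos (hiff.2 h1), if_neg (by omega), if_pos h1.2,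
      Finset.card_insert_of_notMem fun h => hbox (Finset.mem_of_mem_filter _ h)]
    push_cast
    ring
  · have h2 : (if l ≤ j then 1 else if l ≤ k then -1 else 1 : ℝ) = 1 := by
      split_ifs <;> first | rfl | omega
    rw [if_neg (mt hiff.1 h1), h2]
    push_cast
    ring

theorem vertex_eq_add_of_addsBoxAt {N : ℕ} {μ ν : YoungDiagram} {j k : ℕ}
    (h : AddsBoxAt N μ ν j (k + 1)) (l : Circ N) :
    vertex N ν l = vertex N μ l +
      if (l : Fin N).val ≤ j then 1 else if (l : Fin N).val ≤ k then -1 else 1 :=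
  vertexCoord_eq_add_of_addsBoxAt (l : Fin N).isLt h

theorem vertex_bot (N : ℕ) (l : Circ N) :
    vertex N ⊥ l = l.toReal * (N - l.toReal) := by
  simp [vertex, vertexCoord, YoungDiagram.card, Circ.toReal]

/-- Every nonempty partition covers one with one box less, which stays in `𝕐_N`, so induction on the
number of boxes determines the family. -/
theorem obeysRecursion_iff {N : ℕ} [NeZero N] (g : partitionsHookLT N → Circ N → ℝ) :
    ObeysRecursion N g ↔ g = fun ν : partitionsHookLT N => vertex N (ν : YoungDiagram) := by
  constructor
  · rintro ⟨h0, h1⟩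
    funext ⟨ν, hν⟩
    induction hn : ν.card generalizing ν with
    | zero =>
      have hbot : ν = ⊥ := YoungDiagram.ext (Finset.card_eq_zero.1 hn)
      subst hbot
      funext l
      rw [h0 _ rfl, vertex_bot]
    | succ n ih =>
      have hne : ν ≠ ⊥ := by
        rintro rfl
        simp [YoungDiagram.card] at hn
      obtain ⟨μ, hcov⟩ := exists_covBy hne
      have hμ := partitionsHookLT_of_le hcov.le hν
      obtain ⟨j, k, hjk, hk, hadd⟩ := exists_addsBoxAt_of_covBy hν hcov
      have hcard : μ.card = n := by
        have hbox : cellAt N j (k + 1) ∉ μ.cells := hadd.1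
        rw [YoungDiagram.card, hadd.2, Finset.card_insert_of_notMem hbox] at hn
        exact Nat.succ_injective hn
      funext l
      rw [h1 ⟨μ, hμ⟩ ⟨ν, hν⟩ hcov j k hjk hk hadd l, vertex_eq_add_of_addsBoxAt hadd,
        ih μ hμ hcard]
  · rintro rfl
    refine ⟨fun ν hν l => ?_, fun μ ν _ j k _ _ hadd l => vertex_eq_add_of_addsBoxAt hadd l⟩
    simp only [hν, vertex_bot]

theorem dist_rotate {N : ℕ} [NeZero N] (x y : Circ N) :
    dist (rotate N x) (rotate N y) = dist x y := by
  obtain ⟨j, hj, rfl⟩ := exists_pt x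
  obtain ⟨k, hk, rfl⟩ := exists_pt y
  rw [rotate_pt, rotate_pt]
  rcases le_total j k with h | h
  · rw [dist_pt h hk.le, dist_pt (by omega) (by omega)]
    push_cast
    ring
  · rw [dist_comm, dist_comm (pt N j), dist_pt h hj.le, dist_pt (by omega) (by omega)]
    push_cast
    ring

theorem stripExt_comp_rotate {N : ℕ} [NeZero N] (f : Circ N → ℝ) (L : Sym2 (Circ N)) :
    stripExt (f ∘ rotate N) L = stripExt f (Sym2.map (rotate N) L) := by
  induction L using Sym2.ind with
  | _ x y =>
    change (f (rotate N x) + f (rotate N y) - dist x y) / 2 =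
      (f (rotate N x) + f (rotate N y) - dist (rotate N x) (rotate N y)) / 2
    rw [dist_rotate]

/-- The rotated vertex satisfies the rim equations of `ν`, whose solution is unique. -/
theorem vertex_sigma_rotate {N : ℕ} [NeZero N] {ν : YoungDiagram} (hν : ν ∈ partitionsHookLT N) :
    vertex N (sigma N ν) ∘ rotate N = vertex N ν := by
  have h : vertex N (sigma N ν) ∘ rotate N ∈ hyperplaneInter (outerRim N ν) := by
    rw [mem_hyperplaneInter]
    intro L hL
    rw [stripExt_comp_rotate]
    exact mem_hyperplaneInter.1 (vertex_mem_hyperplaneInter (mapsTo_sigma N hν)) _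
      (image_rotate_outerRim_subset hν ⟨L, hL, rfl⟩)
  rwa [hyperplaneInter_outerRim hν, Set.mem_singleton_iff] at h

theorem vertex_pt_eq_card {N : ℕ} [NeZero N] {ν : YoungDiagram} (hν : ν ∈ partitionsHookLT N)
    (l : ℕ) : vertex N ν (pt N l) = ((tau N)^[l] ν).card := by
  induction l generalizing ν with
  | zero => rw [vertex_pt ν (Nat.zero_le N), vertexCoord_zero, Function.iterate_zero_apply]
  | succ l ih =>
    have h := vertex_sigma_rotate (mapsTo_tau N hν)
    rw [sigma_tau hν] at h
    rw [Function.iterate_succ_apply, ← ih (mapsTo_tau N hν), ← h, Function.comp_apply, rotate_pt]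

end Recursion

/-! ### Zero-dimensional faces and tight equations -/

section Faces

/-- The exposing functional is minus the sum of the linear parts of `f̃(L)` over `S`; a common zero
`g` shows that its maximum is attained exactly where all these terms vanish. -/
theorem isExposed_hyperplaneInter {X : Type*} [MetricSpace X] [Fintype X] (S : Set (Sym2 X))
    (hS : (polyhedron X ∩ hyperplaneInter S).Nonempty) :
    IsExposed ℝ (polyhedron X) (polyhedron X ∩ hyperplaneInter S) := by
  classical
  intro _
  obtain ⟨g, hgP, hgS⟩ := hS
  have hsum : ∀ L : Sym2 X, ∃ φ : StrongDual ℝ (X → ℝ), ∀ f h : X → ℝ,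
      φ f - φ h = stripExt h L - stripExt f L := by
    intro L
    induction L using Sym2.ind with
    | _ x y =>
      refine ⟨(-(1 / 2 : ℝ)) • (ContinuousLinearMap.proj (R := ℝ) (φ := fun _ : X => ℝ) x +
        ContinuousLinearMap.proj (R := ℝ) (φ := fun _ : X => ℝ) y),
        fun f h => ?_⟩
      simp only [stripExt, Sym2.lift_mk, smul_apply, add_apply,
        ContinuousLinearMap.proj_apply, smul_eq_mul]
      ring
  choose φ hφ using hsum
  let T : Finset (Sym2 X) := S.toFinite.toFinset
  have hval : ∀ f : X → ℝ,
      (∑ L ∈ T, φ L) g - (∑ L ∈ T, φ L) f = ∑ L ∈ T, stripExt f L := by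
    intro f
    rw [sum_apply, sum_apply, ← Finset.sum_sub_distrib]
    refine Finset.sum_congr rfl fun L hL => ?_
    rw [hφ, mem_hyperplaneInter.1 hgS L (S.toFinite.mem_toFinset.1 hL), sub_zero]
  refine ⟨∑ L ∈ T, φ L, Set.ext fun f => ⟨fun ⟨hfP, hfS⟩ => ⟨hfP, fun h hh => ?_⟩,
    fun ⟨hfP, hmax⟩ => ⟨hfP, mem_hyperplaneInter.2 fun L hL => ?_⟩⟩⟩
  · have h1 := hval f
    rw [Finset.sum_eq_zero fun L hL => mem_hyperplaneInter.1 hfS L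
      (S.toFinite.mem_toFinset.1 hL)] at h1
    have h2 := hval h
    have h3 : 0 ≤ ∑ L ∈ T, stripExt h L := Finset.sum_nonneg fun L _ => hh L
    linarith
  · have h1 := hval f
    have h2 := hmax g hgP
    have h3 : ∑ L ∈ T, stripExt f L = 0 :=
      le_antisymm (by linarith) (Finset.sum_nonneg fun L _ => hfP L)
    exact (Finset.sum_eq_zero_iff_of_nonneg fun L _ => hfP L).1 h3 L
      (S.toFinite.mem_toFinset.2 hL)

/-- At a `0`-face, the hyperplanes through it determine it: a direction in which all the tight
inequalities stay tight is trivial. -/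
theorem eq_zero_of_isExposed_singleton {X : Type*} [MetricSpace X] [Fintype X] {x g : X → ℝ}
    (hx : IsExposed ℝ (polyhedron X) {x})
    (hg : ∀ i j, x i + x j = dist i j → g i + g j = 0) : g = 0 := by
  obtain ⟨φ, hφ⟩ := hx (Set.singleton_nonempty x)
  have hxP : x ∈ polyhedron X := hx.subset rfl
  have hle : ∀ i j, dist i j ≤ x i + x j := fun i j => by
    have : 0 ≤ (x i + x j - dist i j) / 2 := hxP s(i, j)
    linarith
  -- Along `g` tight inequalities stay tight, and the finitely many slack ones survive for small
  -- `ε`.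
  have hev : ∀ᶠ ε in nhds (0 : ℝ), ∀ i j, dist i j ≤ (x i + ε * g i) + (x j + ε * g j) := by
    refine Filter.eventually_all.2 fun i => Filter.eventually_all.2 fun j => ?_
    rcases (hle i j).eq_or_lt with h | h
    · refine Filter.Eventually.of_forall fun ε => ?_
      have := hg i j h.symm
      linear_combination h - ε * this
    · have hc : Continuous fun ε : ℝ => (x i + ε * g i) + (x j + ε * g j) := by fun_prop
      refine (hc.tendsto 0).eventually (eventually_ge_nhds ?_)
      simpa using h
  obtain ⟨δ, hδ, hball⟩ := Metric.eventually_nhds_iff.1 hev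
  have hmem : ∀ ε : ℝ, |ε| < δ → x + ε • g ∈ polyhedron X := by
    intro ε hε L
    induction L using Sym2.ind with
    | _ i j =>
      have h1 := hball (y := ε) (by rwa [dist_zero_right, Real.norm_eq_abs]) i j
      change 0 ≤ ((x i + ε * g i) + (x j + ε * g j) - dist i j) / 2
      linarith
  have hxm : x ∈ {y ∈ polyhedron X | ∀ z ∈ polyhedron X, φ z ≤ φ y} := hφ ▸ rfl
  have h1 := hmem (δ / 2) (by rw [abs_of_pos (by linarith)]; linarith)
  have h2 := hmem (-(δ / 2)) (by rw [abs_neg, abs_of_pos (by linarith)]; linarith)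
  have h3 := hxm.2 _ h1
  have h4 := hxm.2 _ h2
  rw [map_add, map_smul, smul_eq_mul] at h3 h4
  -- Both signs are feasible, so `φ g = 0` and the moved point is a maximizer too.
  have h5 : x + (δ / 2) • g ∈ ({x} : Set (X → ℝ)) := by
    rw [hφ]
    refine ⟨h1, fun z hz => ?_⟩
    have := hxm.2 z hz
    rw [map_add, map_smul, smul_eq_mul]
    linarith
  rw [Set.mem_singleton_iff, add_eq_left] at h5
  exact (smul_eq_zero.1 h5).resolve_left (by linarith)

theorem mem_hullFacesOfDim_zero {X : Type*} [MetricSpace X] [Fintype X] {F : Set (X → ℝ)} :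
    F ∈ hullFacesOfDim X 0 ↔ ∃ x, F = {x} ∧ IsExposed ℝ (polyhedron X) {x} := by
  constructor
  · rintro ⟨⟨⟨x, hx⟩, hexp, -⟩, hdim⟩
    rw [Submodule.finrank_eq_zero, vectorSpan_eq_bot_iff_subsingleton] at hdim
    obtain rfl := hdim.eq_singleton_of_mem hx
    exact ⟨x, rfl, hexp⟩
  · rintro ⟨x, rfl, hx⟩
    exact ⟨⟨Set.singleton_nonempty x, hx, Bornology.isBounded_singleton⟩, by simp⟩

end Faces

/-! ### Every vertex comes from a partition -/

section Converse

/-- The inequality of the polyhedron at the position `(j, k)` of the triangle is an equality. -/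
def IsTight {N : ℕ} [NeZero N] (x : Circ N → ℝ) (j k : ℕ) : Prop :=
  x (pt N j) + x (pt N k) = ((k : ℝ) - j) * (N - (k - j))

theorem isTight_iff {N : ℕ} [NeZero N] {x : Circ N → ℝ} {j k : ℕ} (hjk : j ≤ k) (hk : k ≤ N) :
    IsTight x j k ↔ x (pt N j) + x (pt N k) = dist (pt N j) (pt N k) := by
  rw [IsTight, dist_pt hjk hk]

theorem isTight_self_right {N : ℕ} [NeZero N] {x : Circ N → ℝ} {j : ℕ} :
    IsTight x j N ↔ IsTight x 0 j := by
  rw [IsTight, IsTight, pt_self, add_comm, Nat.cast_zero]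
  ring_nf

/-- Exchanging the ends of nested pairs gives crossing pairs whose distance sum is larger by `2(b -
a)(e - c)`, against the inequalities of the polyhedron. -/
theorem IsTight.not_nested {N : ℕ} [NeZero N] {x : Circ N → ℝ} (hx : x ∈ polyhedron (Circ N))
    {a b c e : ℕ} (hab : a < b) (hbc : b ≤ c) (hce : c < e) (he : e ≤ N)
    (h1 : IsTight x a e) (h2 : IsTight x b c) : False := by
  rw [mem_polyhedron_iff] at hx
  have h3 := hx a c (by omega) (by omega)
  have h4 := hx b e (by omega) he
  rw [IsTight] at h1 h2
  have hab' : (0 : ℝ) < b - a := sub_pos.2 (Nat.cast_lt.2 hab)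
  have hce' : (0 : ℝ) < e - c := sub_pos.2 (Nat.cast_lt.2 hce)
  nlinarith [mul_pos hab' hce']

/-- The same exchange gains `2(c - b)(N - e + a)`; `e < N` keeps this positive even for `a = 0`. -/
theorem IsTight.not_disjoint {N : ℕ} [NeZero N] {x : Circ N → ℝ} (hx : x ∈ polyhedron (Circ N))
    {a b c e : ℕ} (hab : a ≤ b) (hbc : b < c) (hce : c ≤ e) (he : e < N)
    (h1 : IsTight x a b) (h2 : IsTight x c e) : False := by
  rw [mem_polyhedron_iff] at hx
  have h3 := hx a c (by omega) (by omega)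
  have h4 := hx b e (by omega) he.le
  rw [IsTight] at h1 h2
  have hbc' : (0 : ℝ) < c - b := sub_pos.2 (Nat.cast_lt.2 hbc)
  have hae : (0 : ℝ) < N - e + a :=
    add_pos_of_pos_of_nonneg (sub_pos.2 (Nat.cast_lt.2 he)) (Nat.cast_nonneg a)
  nlinarith [mul_pos hbc' hae]

/-- The point `x` is determined by the equalities that hold at `x` among the inequalities of the
polyhedron. -/
def IsRigid {X : Type*} [MetricSpace X] (x : X → ℝ) : Prop :=
  ∀ g : X → ℝ, (∀ i j, x i + x j = dist i j → g i + g j = 0) → g = 0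

theorem IsRigid.eq_zero {N : ℕ} [NeZero N] {x : Circ N → ℝ} (hr : IsRigid x) (g : ℕ → ℝ)
    (hg : ∀ j k, j ≤ k → k < N → IsTight x j k → g j + g k = 0) {l : ℕ} (hl : l < N) :
    g l = 0 := by
  have hval : ∀ j, j < N → ((pt N j : Circ N) : Fin N).val = j := fun j hj => Nat.mod_eq_of_lt hj
  have h := hr (fun i => g (i : Fin N).val) fun i j hij => by
    obtain ⟨a, ha, rfl⟩ := exists_pt i
    obtain ⟨b, hb, rfl⟩ := exists_pt j
    simp only [hval a ha, hval b hb]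
    rcases le_total a b with hab | hab
    · exact hg a b hab hb ((isTight_iff hab hb.le).2 hij)
    · rw [add_comm]
      refine hg b a hab ha ((isTight_iff hab ha.le).2 ?_)
      rw [add_comm, hij, dist_comm]
  have h1 := congrFun h (pt N l)
  simpa only [hval l hl, Pi.zero_apply] using h1

/-- Otherwise the indicator function of `l` would be a free direction. -/
theorem IsRigid.exists_isTight {N : ℕ} [NeZero N] {x : Circ N → ℝ} (hr : IsRigid x) {l : ℕ}
    (hl : l < N) : ∃ i < N, i ≤ l ∧ IsTight x i l ∨ l ≤ i ∧ IsTight x l i := by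
  by_contra! hcon
  have h := hr.eq_zero (fun i => if i = l then 1 else 0) (fun j k hjk hk ht => by
    have hj : j ≠ l := by
      rintro rfl
      exact (hcon k hk).2 hjk ht
    have hk' : k ≠ l := by
      rintro rfl
      exact (hcon j (by omega)).1 hjk ht
    simp [hj, hk']) hl
  simp at h

/-- The tight positions cannot be split into two parts as in the recursion step, since the step
function would be a direction in which they all stay tight. -/
theorem IsRigid.not_splits {N : ℕ} [NeZero N] {x : Circ N → ℝ} (hr : IsRigid x) {p a b : ℕ}
    (hap : a < p) (hpb : p < b)
    (hp : ∀ j k, j ≤ k → k < N → IsTight x j k → j ≤ p ∧ p ≤ k)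
    (h : ∀ j k, j ≤ p → p ≤ k → k < N → IsTight x j k → j ≤ a ∧ k < b ∨ a < j ∧ b ≤ k) :
    False := by
  have h1 := hr.eq_zero (fun l => if l ≤ a then 1 else if l < b then -1 else 1)
    (fun j k hjk hk ht => by
      obtain ⟨hj, hk'⟩ := hp j k hjk hk ht
      have h2 : ¬ k ≤ a := by omega
      have h3 : j < b := by omega
      rcases h j k hj hk' hk ht with ⟨h4, h5⟩ | ⟨h4, h5⟩
      · simp [h4, h2, h5]
      · simp [h4.not_ge, h3, h2, h5.not_gt]) (NeZero.pos N)
  simp at h1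

theorem exists_outerRim_tight {N : ℕ} [NeZero N] {x : Circ N → ℝ}
    (hx : x ∈ polyhedron (Circ N)) (hr : IsRigid x) :
    ∃ ν ∈ partitionsHookLT N, x ∈ hyperplaneInter (outerRim N ν) := by
  classical
  have hN := NeZero.pos N
  have hex : ∃ i, i < N ∧ IsTight x 0 i := by
    obtain ⟨i, hi, ⟨h0, ht⟩ | ⟨h0, ht⟩⟩ := hr.exists_isTight hN
    · obtain rfl : i = 0 := by omega
      exact ⟨0, hN, ht⟩
    · exact ⟨i, hi, ht⟩
  -- The least partner of `0` becomes the first row length; minimality excludes tight positions `(0,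
  -- k)` with `k < p`, which `not_nested` does not cover.
  obtain ⟨p, ⟨hpN, hp0⟩, hpmin⟩ : ∃ p, (p < N ∧ IsTight x 0 p) ∧
      ∀ i, i < p → ¬ (i < N ∧ IsTight x 0 i) :=
    ⟨Nat.find hex, Nat.find_spec hex, fun i hi => Nat.find_min hex hi⟩
  have hpR : IsTight x p N := isTight_self_right.2 hp0
  have hcross : ∀ j k, j ≤ k → k < N → IsTight x j k → j ≤ p ∧ p ≤ k := by
    intro j k hjk hk ht
    constructor
    · by_contra! hj
      exact IsTight.not_disjoint hx (Nat.zero_le p) hj hjk hk hp0 ht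
    · by_contra! hk'
      rcases Nat.eq_zero_or_pos j with rfl | hj
      · exact hpmin k hk' ⟨hk, ht⟩
      · exact IsTight.not_nested hx hj hjk hk' hpN.le hp0 ht
  have hleft : ∀ j, j ≤ p → ∃ k, p ≤ k ∧ k ≤ N ∧ IsTight x j k := by
    intro j hj
    rcases hj.lt_or_eq with hj | rfl
    · obtain ⟨i, hi, ⟨h0, ht⟩ | ⟨h0, ht⟩⟩ := hr.exists_isTight (hj.trans hpN)
      · exact absurd (hcross i j h0 (hj.trans hpN) ht).2 (by omega)
      · exact ⟨i, (hcross j i h0 hi ht).2, hi.le, ht⟩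
    · exact ⟨N, hpN.le, le_rfl, hpR⟩
  have hright : ∀ k, p ≤ k → k ≤ N → ∃ j, j ≤ p ∧ IsTight x j k := by
    intro k hpk hkN
    rcases hkN.lt_or_eq with hk | rfl
    · rcases hpk.lt_or_eq with hpk | rfl
      · obtain ⟨i, hi, ⟨h0, ht⟩ | ⟨h0, ht⟩⟩ := hr.exists_isTight hk
        · exact ⟨i, (hcross i k h0 hk ht).1, ht⟩
        · exact absurd (hcross k i h0 hi ht).1 (by omega)
      · exact ⟨0, Nat.zero_le _, hp0⟩
    · exact ⟨p, le_rfl, hpR⟩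
  have hchain : ∀ j k j' k', j' ≤ p → p ≤ k' → k ≤ N → IsTight x j k → IsTight x j' k' →
      j < j' → k ≤ k' := by
    intro j k j' k' h1 h2 h3 h4 h5 h6
    by_contra! h7
    exact IsTight.not_nested hx h6 (h1.trans h2) h7 h3 h4 h5
  -- The diagram consists of the cells strictly below some tight position.
  let P : ℕ × ℕ → Prop := fun y =>
    ∃ j k, j ≤ p ∧ p ≤ k ∧ k ≤ N ∧ IsTight x j k ∧ y.2 < j ∧ y.1 + k < N
  let ν : YoungDiagram := ⟨(Finset.range N ×ˢ Finset.range N).filter P, by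
    rintro ⟨r, c⟩ ⟨r', c'⟩ ⟨hr', hc'⟩ hm
    simp only [Finset.coe_filter, Finset.mem_product, Finset.mem_range, Set.mem_ofPred_eq] at hm ⊢
    obtain ⟨hm1, j, k, h1, h2, h3, h4, h5, h6⟩ := hm
    simp only at hr' hc' h5 h6
    exact ⟨by omega, j, k, h1, h2, h3, h4, by simp only; omega, by simp only; omega⟩⟩
  have hmem : ∀ r c, (r, c) ∈ ν ↔
      ∃ j k, j ≤ p ∧ p ≤ k ∧ k ≤ N ∧ IsTight x j k ∧ c < j ∧ r + k < N := by
    intro r c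
    change (r, c) ∈ (Finset.range N ×ˢ Finset.range N).filter P ↔ _
    rw [Finset.mem_filter, Finset.mem_product, Finset.mem_range, Finset.mem_range]
    refine ⟨fun h => h.2, fun h => ⟨?_, h⟩⟩
    obtain ⟨j, k, h1, h2, h3, h4, h5, h6⟩ := h
    simp only
    omega
  have hlen : ν.rowLen 0 = p := by
    refine rowLen_eq_of_forall fun c => ?_
    rw [hmem]
    constructor
    · rintro ⟨j, k, h1, h2, h3, h4, h5, h6⟩
      omega
    · intro hc
      by_contra! hcon
      have hmax : ∀ k, p ≤ k → k < N → ¬ IsTight x p k := fun k hk hkN ht => by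
        have := hcon p k le_rfl hk hkN.le ht hc
        omega
      -- If no `(p, k)` with `k < N` is tight, the function that is `1` before `p` and `-1` from `p`
      -- on is a free direction.
      refine hr.not_splits (a := p - 1) (b := N) (by omega) hpN hcross fun j k hj hk hkN ht => ?_
      rcases hj.lt_or_eq with hj | rfl
      · exact Or.inl ⟨by omega, hkN⟩
      · exact absurd ht (hmax k hk hkN)
  have hν : ν ∈ partitionsHookLT N := by
    rw [mem_partitionsHookLT_iff, hlen]
    have : ν.colLen 0 ≤ N - p := by
      by_contra! hlt
      obtain ⟨j, k, h1, h2, h3, h4, h5, h6⟩ := (hmem _ _).1 (YoungDiagram.mem_iff_lt_colLen.2 hlt)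
      omega
    omega
  refine ⟨ν, hν, mem_hyperplaneInter.2 fun L hL => ?_⟩
  obtain ⟨j, k, h1, h2, h3, h4, h5, rfl⟩ := hL
  rw [hlen] at h1 h2
  suffices ht : IsTight x j k by
    rw [IsTight] at ht
    rw [stripExt_site x (h1.trans h2) h3, ht, sub_self, zero_div]
  by_contra hnt
  rw [cellAt, hmem] at h4
  have h4' : ∀ j' k', j' ≤ p → p ≤ k' → IsTight x j' k' → k' < k → j' ≤ j := by
    intro j' k' hj' hk' ht hlt
    by_contra! hlt'
    exact h4 ⟨j', k', hj', hk', by omega, ht, hlt', by omega⟩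
  -- A tight position weakly beyond `(j, k)`: an edge point of the rim, or a witness for the box at
  -- `(j - 1, k + 1)`.
  obtain ⟨j₁, k₁, hj₁, hk₁, hkN₁, ht₁, hle₁, hle₁'⟩ : ∃ j₁ k₁, j₁ ≤ p ∧ p ≤ k₁ ∧ k₁ ≤ N ∧
      IsTight x j₁ k₁ ∧ j ≤ j₁ ∧ k₁ ≤ k := by
    rcases Nat.eq_zero_or_pos j with rfl | hj
    · exact ⟨0, p, Nat.zero_le _, le_rfl, hpN.le, hp0, le_rfl, h2⟩
    rcases h3.lt_or_eq with hk | rfl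
    · obtain ⟨j₁, k₁, g1, g2, g3, g4, g5, g6⟩ := (hmem _ _).1
        (h5 (j - 1) (k + 1) (by omega) (by omega) hk)
      exact ⟨j₁, k₁, g1, g2, g3, g4, by omega, by omega⟩
    · exact ⟨p, k, le_rfl, h2, le_rfl, hpR, h1, le_rfl⟩
  have hne : ¬ (j₁ = j ∧ k₁ = k) := by
    rintro ⟨rfl, rfl⟩
    exact hnt ht₁
  -- As `(j, k)` is not a box, `(j₁, k₁)` shares a coordinate with it. The chain property supplies a
  -- tight position for the other coordinate, so the chain jumps across `(j, k)`.
  obtain ⟨b, hpb, hbk, htb, a, hap, hja, hta⟩ : ∃ b, p ≤ b ∧ b < k ∧ IsTight x j b ∧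
      ∃ a, a ≤ p ∧ j < a ∧ IsTight x a k := by
    rcases hle₁.lt_or_eq with hj | rfl
    · have hk : k₁ = k := by
        by_contra hk
        have := h4' j₁ k₁ hj₁ hk₁ ht₁ (by omega)
        omega
      subst hk
      obtain ⟨b, hpb, hbN, htb⟩ := hleft j h1
      have hbk := hchain j b j₁ k₁ hj₁ h2 hbN htb ht₁ hj
      refine ⟨b, hpb, lt_of_le_of_ne hbk ?_, htb, j₁, hj₁, hj, ht₁⟩
      rintro rfl
      exact hnt htb
    · have hk : k₁ < k := by omega
      obtain ⟨a, hap, hta⟩ := hright k h2 h3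
      refine ⟨k₁, hk₁, hk, ht₁, a, hap, ?_, hta⟩
      by_contra! ha
      rcases ha.lt_or_eq with ha | rfl
      · have := hchain a k j k₁ h1 hk₁ h3 hta ht₁ ha
        omega
      · exact hnt hta
  -- The tight positions split at the missing `(j, k)`, which contradicts rigidity.
  refine hr.not_splits (a := j) (b := k) (by omega) (by omega) hcross
    fun j' k' hj' hk' hkN' ht => ?_
  rcases lt_or_ge k' k with hlt | hge
  · exact Or.inl ⟨h4' j' k' hj' hk' ht hlt, hlt⟩
  · refine Or.inr ⟨?_, hge⟩
    by_contra! hle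
    rcases hle.lt_or_eq with hlt | rfl
    · have := hchain j' k' j b h1 hpb hkN'.le ht htb hlt
      omega
    · have := hchain j' k' a k hap h2 hkN'.le ht hta hja
      obtain rfl : k' = k := by omega
      exact hnt ht

theorem hullFacesOfDim_zero {N : ℕ} [NeZero N] :
    hullFacesOfDim (Circ N) 0 = Set.range (fun ν : partitionsHookLT N =>
      hyperplaneInter (outerRim N (ν : YoungDiagram))) := by
  ext F
  rw [mem_hullFacesOfDim_zero, Set.mem_range]
  constructor
  · rintro ⟨x, rfl, hx⟩
    obtain ⟨ν, hν, hxν⟩ := exists_outerRim_tight (hx.subset rfl)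
      fun _ => eq_zero_of_isExposed_singleton hx
    exact ⟨⟨ν, hν⟩, (subsingleton_hyperplaneInter_outerRim hν).eq_singleton_of_mem hxν⟩
  · rintro ⟨⟨ν, hν⟩, rfl⟩
    refine ⟨vertex N ν, hyperplaneInter_outerRim hν, ?_⟩
    have hinter : polyhedron (Circ N) ∩ hyperplaneInter (outerRim N ν) = {vertex N ν} := by
      rw [hyperplaneInter_outerRim hν]
      exact Set.inter_eq_right.2 (Set.singleton_subset_iff.2 (vertex_mem_polyhedron hν))
    rw [← hinter]
    exact isExposed_hyperplaneInter _ (hinter ▸ Set.singleton_nonempty _)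

end Converse

end InjHullYoung

open InjHullYoung
theorem mainTheorem2 (N : ℕ) [NeZero N] (hN : 2 ≤ N) :
    ∃ f : partitionsHookLT N → (Circ N → ℝ),
      -- `f_λ` is the unique point of the hyperplanes of the outer rim, and it lies in `E(X)`
      (∀ ν : partitionsHookLT N, hyperplaneInter (outerRim N (ν : YoungDiagram)) = {f ν}) ∧
      (∀ ν : partitionsHookLT N, f ν ∈ injHull (Circ N)) ∧
      -- the `0`-faces of `E(X)` are precisely the singletons `{f_λ}`
      hullFacesOfDim (Circ N) 0 =
        Set.range (fun ν : partitionsHookLT N =>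
          hyperplaneInter (outerRim N (ν : YoungDiagram))) ∧
      -- every covering adds a box at some `(j, k+1)`, which leaves the outer rim
      (∀ μ ν : partitionsHookLT N, (μ : YoungDiagram) ⋖ (ν : YoungDiagram) →
        ∃ j k : ℕ, j < k ∧ k ≤ N - 1 ∧ AddsBoxAt N μ ν j (k + 1)) ∧
      (∀ μ ν : partitionsHookLT N, ∀ j k : ℕ, j < k → k ≤ N - 1 → AddsBoxAt N μ ν j (k + 1) →
        site N j (k + 1) ∈ outerRim N (μ : YoungDiagram) ∧
        site N j (k + 1) ∉ outerRim N (ν : YoungDiagram)) ∧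
      -- the family `f` is determined by the recursive procedure
      (∀ g : partitionsHookLT N → Circ N → ℝ, ObeysRecursion N g ↔ g = f) ∧
      -- `σ` is the cyclic action that comes from translation in the Möbius strip
      Set.MapsTo (sigma N) (partitionsHookLT N) (partitionsHookLT N) ∧
      (∀ ν ∈ partitionsHookLT N,
        outerRim N (sigma N ν) = Sym2.map (rotate N) '' outerRim N ν) ∧
      -- `τ` is its inverse, with its explicit description
      Set.MapsTo (tau N) (partitionsHookLT N) (partitionsHookLT N) ∧
      Set.InvOn (tau N) (sigma N) (partitionsHookLT N) (partitionsHookLT N) ∧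
      (∀ ν ∈ partitionsHookLT N, (tau N ν).rowLens = tauRows N ν) ∧
      -- the direct formulas
      (∀ ν : partitionsHookLT N, f ν (pt N 0) = ((ν : YoungDiagram).card : ℝ)) ∧
      (∀ (ν : partitionsHookLT N) (l : Circ N),
        f ν l = (((tau N)^[(l : Fin N).val] (ν : YoungDiagram)).card : ℝ)) := by
  refine ⟨fun ν => vertex N ν, fun ν => hyperplaneInter_outerRim ν.2,
    fun ν => vertex_mem_injHull ν.2, hullFacesOfDim_zero,
    fun μ ν h => exists_addsBoxAt_of_covBy ν.2 h,
    fun μ ν j k _ hk h => site_mem_outerRim_of_addsBoxAt ν.2 hk h,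
    obeysRecursion_iff, mapsTo_sigma N, fun ν hν => outerRim_sigma hν, mapsTo_tau N,
    ⟨fun ν hν => tau_sigma hν, fun ν hν => sigma_tau hν⟩, fun ν hν => rowLens_tau hν,
    fun ν => vertex_pt_eq_card ν.2 0, fun ν l => ?_⟩
  rw [← vertex_pt_eq_card ν.2, pt_val]
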